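/- Let $\mathbb{M}$ be a connected smooth Riemannian manifold of dimension $d$ without boundary, with Riemannian distance $\mathrm{dist}$, open balls $B(x,r)$, Riemannian volume measure $\mu$ (given in charts by $\sqrt{\det(g_{ij})}\,dx_1\cdots dx_d$) and exponential maps $\mathrm{Exp}_x$. For $p:\mathbb{M}\to\mathbb{R}$ and $S\subset\mathbb{M}$ write $\|p\|_{C(S)}=\sup_{x\in S}|p(x)|$ and $\|\nabla p\|_{C(S)}=\sup_{x\in S}\sup_{0\ne V\in T\mathbb{M}_x}|\nabla p(x)(V)|/\|V\|$ (values in $[0,\infty]$). Let $\varPi\subset C^1(\mathbb{M})$ be a finite dimensional space of real functions for which there are constants $\mathfrak{D},\mathfrak{M}$ and $r^\sharp>0$ such that for all $p\in\varPi$, $0<r<r^\sharp$ and $x\in\mathbb{M}$, $$\|p\|_{C(B(x,2r))}\le 2^{\mathfrak{D}}\|p\|_{C(B(x,r))},\qquad \|\nabla p\|_{C(B(x,r))}\le\frac{\mathfrak{M}}{r}\|p\|_{C(B(x,r))}.$$ Let $\Omega\subset\mathbb{M}$ be compact and satisfy an interior cone condition of radius $r^\flat>0$ and aperture $\omega\in(0,\pi/2)$: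 for every $z\in\Omega$ there is a unit vector $v\in T\mathbb{M}_z$ such that $\mathrm{Exp}_z$ is defined on the cone $C=\{w\in T\mathbb{M}_z : \|w\|\le r^\flat,\ \langle v,w\rangle\ge\|w\|\cos\omega\}$ and $\mathrm{Exp}_z(C)\subset\Omega$. Let $r_\Omega=\inf_{x\in\Omega}r_x$, where the injectivity radius $r_x\in(0,\infty]$ is the supremum of all $r>0$ such that $\mathrm{Exp}_x$ is defined on the open ball of radius $r$ around $0\in T\mathbb{M}_x$ and is there a smooth diffeomorphism onto an open subset of $\mathbb{M}$. Put $r^*=\min(r_\Omega,r^\sharp,r^\flat)$. Then there is a constant $\mathfrak{N}>0$ such that for all real $1\le q<\infty$, all $x_0\in\Omega$, all $0<R\le r^*$ and all $p\in\varPi$, $$\|p\|_{C(\overline{B(x_0,R)}\cap\Omega)}\le\mathfrak{N}\,R^{-d/q}\,\|p\|_{L_q(B(x_0,R)\cap\Omega)},$$ where the $L_q$ norm is taken with respect to $\mu$. -/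

import Mathlib

open scoped Bundle Manifold ContDiff ENNReal Topology

noncomputable section

namespace RiemannianNikolskii

section Defs

variable {d : ℕ} {M : Type*} [MetricSpace M] [ChartedSpace (EuclideanSpace ℝ (Fin d)) M]

/-! ### Riemannian metric, Christoffel symbols and volume in charts

Throughout, `e` is a chart of the manifold, a homeomorphism from an open subset of `M` onto an
open subset of `ℝᵈ`, and `𝓡 d` is the model of `d`-dimensional manifolds without boundary. -/

section Metric

variable [Bundle.RiemannianBundle (fun x : M => TangentSpace (𝓡 d) x)]

/-- The metric tensor in the chart `e`: for a point `y` of the target of `e`, the bilinear form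
`g_y(a, b) = ∑ g_ij(y) a_i b_j` on coordinate vectors `a`, `b`. -/
def chartMetric (e : OpenPartialHomeomorph M (EuclideanSpace ℝ (Fin d)))
    (y a b : EuclideanSpace ℝ (Fin d)) : ℝ :=
  inner ℝ (mfderiv (𝓡 d) (𝓡 d) e.symm y a) (mfderiv (𝓡 d) (𝓡 d) e.symm y b)

/-- The derivative `(∂_c g)_y(a, b)` of the metric tensor in the chart `e`, in direction `c`. -/
def chartMetricDeriv (e : OpenPartialHomeomorph M (EuclideanSpace ℝ (Fin d)))
    (y c a b : EuclideanSpace ℝ (Fin d)) : ℝ :=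
  fderiv ℝ (fun y' => chartMetric e y' a b) y c

/-- The Christoffel symbols of the first kind in the chart `e`, as a trilinear form:
`Γ(a, b; c) = ½ (∂_a g(b, c) + ∂_b g(a, c) - ∂_c g(a, b))`. -/
def christoffel (e : OpenPartialHomeomorph M (EuclideanSpace ℝ (Fin d)))
    (y a b c : EuclideanSpace ℝ (Fin d)) : ℝ :=
  (chartMetricDeriv e y a b c + chartMetricDeriv e y b a c - chartMetricDeriv e y c a b) / 2

/-- The volume density `√(det (g_ij))` in the chart `e`. -/
def volumeDensity (e : OpenPartialHomeomorph M (EuclideanSpace ℝ (Fin d)))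
    (y : EuclideanSpace ℝ (Fin d)) : ℝ :=
  Real.sqrt (Matrix.det (Matrix.of fun i j : Fin d =>
    chartMetric e y (EuclideanSpace.single i 1) (EuclideanSpace.single j 1)))

/-- The measure `√(det (g_ij)) dx₁ ⋯ dx_d` on the domain of the chart `e`, extended by zero to
the rest of `M`. -/
def chartVolume [MeasurableSpace M]
    (e : OpenPartialHomeomorph M (EuclideanSpace ℝ (Fin d))) : MeasureTheory.Measure M :=
  ((MeasureTheory.volume.restrict e.target).withDensity
    (fun y => ENNReal.ofReal (volumeDensity e y))).map e.symm

/-- The Riemannian volume measure `μ` of `M`, glued from the chart measures. These agree on the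
overlaps of charts, so the glued measure, which restricts to `chartVolume e` on the domain of
every chart `e`, is their least upper bound in the lattice of measures on `M`. -/
def riemannianVolume (d : ℕ) (M : Type*) [MetricSpace M]
    [ChartedSpace (EuclideanSpace ℝ (Fin d)) M]
    [Bundle.RiemannianBundle (fun x : M => TangentSpace (𝓡 d) x)] [MeasurableSpace M] :
    MeasureTheory.Measure M :=
  ⨆ e ∈ atlas (EuclideanSpace ℝ (Fin d)) M, chartVolume e

/-! ### Geodesics and the exponential map -/

/-- The curve `γ` is twice continuously differentiable near `t` and satisfies the geodesic
equation at `t`: for the expression `u = e ∘ γ` in any chart `e` around `γ t`,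
`g(u'', c) + Γ(u', u'; c) = 0` for all coordinate vectors `c`, that is,
`u''_k + ∑ Γ^k_ij u'_i u'_j = 0` for all `k`. -/
def IsGeodesicAt (d : ℕ) {M : Type*} [MetricSpace M]
    [ChartedSpace (EuclideanSpace ℝ (Fin d)) M]
    [Bundle.RiemannianBundle (fun x : M => TangentSpace (𝓡 d) x)] (γ : ℝ → M) (t : ℝ) : Prop :=
  ContMDiffAt 𝓘(ℝ, ℝ) (𝓡 d) 2 γ t ∧
    ∀ e ∈ atlas (EuclideanSpace ℝ (Fin d)) M, γ t ∈ e.source → ∀ c : EuclideanSpace ℝ (Fin d),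
      chartMetric e (e (γ t)) (deriv (deriv (e ∘ γ)) t) c
        + christoffel e (e (γ t)) (deriv (e ∘ γ) t) (deriv (e ∘ γ) t) c = 0

/-- `γ` is a geodesic, defined on an open interval containing `[0, 1]`, with `γ(0) = x` and
`γ'(0) = v`. -/
def IsGeodesicFrom (x : M) (v : TangentSpace (𝓡 d) x) (γ : ℝ → M) : Prop :=
  (∃ ε : ℝ, 0 < ε ∧ ∀ t ∈ Set.Ioo (-ε) (1 + ε), IsGeodesicAt d γ t) ∧
    (⟨γ 0, mfderiv 𝓘(ℝ, ℝ) (𝓡 d) γ 0 (1 : ℝ)⟩ : TangentBundle (𝓡 d) M) = ⟨x, v⟩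

/-- The domain of the exponential map at `x`: the tangent vectors `v` for which the geodesic
that starts at `x` with velocity `v` exists up to time `1`. -/
def expDomain (x : M) : Set (TangentSpace (𝓡 d) x) :=
  {v | ∃ γ : ℝ → M, IsGeodesicFrom x v γ}

open Classical in
/-- The exponential map `Exp_x`: the point at time `1` of the geodesic that starts at `x` with
velocity `v`. (Geodesics with given initial data are unique. Outside of `expDomain x` the value
`x` is a dummy.) -/
def riemannianExp (x : M) (v : TangentSpace (𝓡 d) x) : M :=
  if h : ∃ γ : ℝ → M, IsGeodesicFrom x v γ then h.choose 1 else x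

/-- `Exp_x` is defined on the open ball of radius `r` around `0` in the tangent space at `x`, and
is there a smooth diffeomorphism onto an open subset of `M`. -/
def IsExpDiffeoOn (d : ℕ) {M : Type*} [MetricSpace M]
    [ChartedSpace (EuclideanSpace ℝ (Fin d)) M]
    [Bundle.RiemannianBundle (fun x : M => TangentSpace (𝓡 d) x)] (x : M) (r : ℝ) : Prop :=
  Metric.ball (0 : TangentSpace (𝓡 d) x) r ⊆ expDomain x ∧
    ∃ Φ : PartialDiffeomorph 𝓘(ℝ, TangentSpace (𝓡 d) x) (𝓡 d) (TangentSpace (𝓡 d) x) M ∞,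
      Φ.source = Metric.ball 0 r ∧
        ∀ v ∈ Metric.ball (0 : TangentSpace (𝓡 d) x) r, Φ v = riemannianExp x v

/-- The injectivity radius `r_x` at the point `x` (infinite for instance in `ℝᵈ`). -/
def injectivityRadius (d : ℕ) {M : Type*} [MetricSpace M]
    [ChartedSpace (EuclideanSpace ℝ (Fin d)) M]
    [Bundle.RiemannianBundle (fun x : M => TangentSpace (𝓡 d) x)] (x : M) : ℝ≥0∞ :=
  ⨆ (r : ℝ) (_ : 0 < r) (_ : IsExpDiffeoOn d x r), ENNReal.ofReal r

/-- The injectivity radius `r_Ω` of a subset `Ω` of `M`. -/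
def injectivityRadiusOn (d : ℕ) {M : Type*} [MetricSpace M]
    [ChartedSpace (EuclideanSpace ℝ (Fin d)) M]
    [Bundle.RiemannianBundle (fun x : M => TangentSpace (𝓡 d) x)] (Ω : Set M) : ℝ≥0∞ :=
  ⨅ x ∈ Ω, injectivityRadius d x

/-! ### Norms and the two assumptions -/

/-- The supremum norm `‖p‖_{C(s)}` of `p` on the set `s`, with values in `[0, ∞]`. -/
def supNorm {M : Type*} (p : M → ℝ) (s : Set M) : ℝ≥0∞ :=
  ⨆ x ∈ s, ‖p x‖ₑ

/-- The norm of the covector `∇p(x)`, that is, the supremum of `|∇p(x)(V)| / ‖V‖` over the nonzero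
tangent vectors `V` at `x`. -/
def gradNorm (d : ℕ) {M : Type*} [MetricSpace M]
    [ChartedSpace (EuclideanSpace ℝ (Fin d)) M]
    [Bundle.RiemannianBundle (fun x : M => TangentSpace (𝓡 d) x)] (p : M → ℝ) (x : M) : ℝ≥0∞ :=
  ⨆ (V : TangentSpace (𝓡 d) x) (_ : V ≠ 0),
    ENNReal.ofReal (|(show ℝ from mfderiv (𝓡 d) 𝓘(ℝ, ℝ) p x V)| / ‖V‖)

/-- The supremum norm `‖∇p‖_{C(s)}` on the set `s`, with values in `[0, ∞]`. -/
def gradSupNorm (d : ℕ) {M : Type*} [MetricSpace M]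
    [ChartedSpace (EuclideanSpace ℝ (Fin d)) M]
    [Bundle.RiemannianBundle (fun x : M => TangentSpace (𝓡 d) x)] (p : M → ℝ) (s : Set M) :
    ℝ≥0∞ :=
  ⨆ x ∈ s, gradNorm d p x

/-- `P` is a finite dimensional space of `C¹` functions on `M` with the doubling property
`‖p‖_{C(B(x,2r))} ≤ 2^D ‖p‖_{C(B(x,r))}` and the Markov inequality
`‖∇p‖_{C(B(x,r))} ≤ (K / r) ‖p‖_{C(B(x,r))}` for all `p ∈ P`, `x ∈ M` and `0 < r < rs`. -/
structure FunctionSpaceAssumption (d : ℕ) {M : Type*} [MetricSpace M]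
    [ChartedSpace (EuclideanSpace ℝ (Fin d)) M]
    [Bundle.RiemannianBundle (fun x : M => TangentSpace (𝓡 d) x)]
    (P : Submodule ℝ (M → ℝ)) (D K rs : ℝ) : Prop where
  finiteDimensional : FiniteDimensional ℝ P
  contMDiff : ∀ p ∈ P, ContMDiff (𝓡 d) 𝓘(ℝ, ℝ) 1 p
  rs_pos : 0 < rs
  doubling : ∀ p ∈ P, ∀ r : ℝ, 0 < r → r < rs → ∀ x : M,
    supNorm p (Metric.ball x (2 * r)) ≤ ENNReal.ofReal (2 ^ D) * supNorm p (Metric.ball x r)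
  markov : ∀ p ∈ P, ∀ r : ℝ, 0 < r → r < rs → ∀ x : M,
    gradSupNorm d p (Metric.ball x r) ≤ ENNReal.ofReal (K / r) * supNorm p (Metric.ball x r)

/-- The closed cone of radius `r` and aperture `θ` around the direction `v` in the tangent space
at `z`. -/
def tangentCone {z : M} (r θ : ℝ) (v : TangentSpace (𝓡 d) z) : Set (TangentSpace (𝓡 d) z) :=
  {w | ‖w‖ ≤ r ∧ Real.cos θ * ‖w‖ ≤ inner ℝ v w}

/-- `Ω` is compact and satisfies the interior cone condition of radius `rb` and aperture `θ`: at
each point `z` of `Ω` there is a unit tangent vector `v` such that `Exp_z` is defined on the cone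
around `v` and maps it into `Ω`. -/
structure DomainAssumption (d : ℕ) {M : Type*} [MetricSpace M]
    [ChartedSpace (EuclideanSpace ℝ (Fin d)) M]
    [Bundle.RiemannianBundle (fun x : M => TangentSpace (𝓡 d) x)]
    (Ω : Set M) (rb θ : ℝ) : Prop where
  isCompact : IsCompact Ω
  rb_pos : 0 < rb
  aperture_pos : 0 < θ
  aperture_lt : θ < Real.pi / 2
  cone : ∀ z ∈ Ω, ∃ v : TangentSpace (𝓡 d) z, ‖v‖ = 1 ∧
    tangentCone rb θ v ⊆ expDomain z ∧ ∀ w ∈ tangentCone rb θ v, riemannianExp z w ∈ Ω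

/-- The parameter `r* = min(r_Ω, rs, rb)`. -/
def rStar (d : ℕ) {M : Type*} [MetricSpace M]
    [ChartedSpace (EuclideanSpace ℝ (Fin d)) M]
    [Bundle.RiemannianBundle (fun x : M => TangentSpace (𝓡 d) x)] (Ω : Set M) (rs rb : ℝ) :
    ℝ≥0∞ :=
  min (injectivityRadiusOn d Ω) (min (ENNReal.ofReal rs) (ENNReal.ofReal rb))

end Metric

end Defs

end RiemannianNikolskii

end

/-! The cone condition puts a ball B(y, ρR) inside B(x₀, R) ∩ Ω, with ρ independent of x₀ and R.
Choose r comparable to R with 2r < ρR and 2^k r = 3R/2. Since y lies within R/4 of x₀, the ball B(y,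
2^k r) covers the closure of B(x₀, R), so k doublings bound the left side by a constant times m, the
supremum of |p| on B(y, r). The Markov inequality on B(y, 2r), followed by one doubling, bounds the
gradient there by a multiple of m/r. So |p| ≥ m/4 on a ball of radius comparable to R around a point
where |p| > m/2. Such a ball has volume at least a constant times R^d, hence the L_q norm is at
least a constant times m R^(d/q) (`FunctionSpaceAssumption.exists_large_on_ball`,
`ofReal_mul_rpow_le_eLpNorm`).

The geometry behind this is local and is made uniform by compactness of Ω. In a chart the metric is
comparable to the Euclidean one and the geodesic equation is u'' = -B(u)(u', u') with B bounded and
Lipschitz. Comparing two short solutions shows that Exp_z, read in the chart, is a small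
perturbation of a linear map (`geodesic_chart_sub`). A quantitative inverse function theorem then
turns a ball of tangent vectors inside the cone into a ball inside Ω (`exists_ball_subset_of_cone`).
Existence of the geodesics comes with the cone condition. -/

noncomputable section

namespace RiemannianNikolskii

/-! ### Comparison of short solutions of the geodesic equation. -/

section ODE


variable {E : Type*} [NormedAddCommGroup E] [NormedSpace ℝ E]

/-- On the unit interval, the increment of a function is bounded by a bound of its derivative. -/
theorem norm_sub_zero_le_of_hasDerivAt {f f' : ℝ → E} {C : ℝ} {T : ℝ} (hT : T ≤ 1)
    (hf : ∀ t ∈ Set.Icc 0 T, HasDerivAt f (f' t) t) (hC : ∀ t ∈ Set.Icc 0 T, ‖f' t‖ ≤ C)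
    {t : ℝ} (ht : t ∈ Set.Icc 0 T) : ‖f t - f 0‖ ≤ C := by
  have h0 : (0 : ℝ) ∈ Set.Icc 0 T := ⟨le_rfl, ht.1.trans ht.2⟩
  have h := (convex_Icc (0 : ℝ) T).norm_image_sub_le_of_norm_hasDerivWithin_le
    (fun x hx => (hf x hx).hasDerivWithinAt) hC h0 ht
  have hC0 : 0 ≤ C := (norm_nonneg _).trans (hC 0 h0)
  have : ‖t - 0‖ ≤ 1 := by
    rw [sub_zero, Real.norm_of_nonneg ht.1]; exact ht.2.trans hT
  nlinarith

theorem norm_quadratic_sub_le (S T : E →L[ℝ] E →L[ℝ] E) {v w : E} {a b C : ℝ}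
    (ha : ‖v‖ ≤ a) (hb : ‖w‖ ≤ a) (hST : ‖S - T‖ ≤ b) (hT : ‖T‖ ≤ C) :
    ‖S v v - T w w‖ ≤ b * a ^ 2 + 2 * C * a * ‖v - w‖ := by
  have h : S v v - T w w = (S - T) v v + (T (v - w) v + T w (v - w)) := by
    simp only [_root_.sub_apply, map_sub]; abel
  have ha0 : 0 ≤ a := (norm_nonneg _).trans ha
  have hb0 : 0 ≤ b := (norm_nonneg (S - T)).trans hST
  have hC0 : 0 ≤ C := (norm_nonneg T).trans hT
  have h1 : ‖(S - T) v v‖ ≤ b * a * a :=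
    ((S - T).le_opNorm₂ v v).trans (by gcongr)
  have h2 : ‖T (v - w) v‖ ≤ C * ‖v - w‖ * a := (T.le_opNorm₂ _ _).trans (by gcongr)
  have h3 : ‖T w (v - w)‖ ≤ C * a * ‖v - w‖ := (T.le_opNorm₂ _ _).trans (by gcongr)
  rw [h]
  refine (norm_add_le _ _).trans ?_
  have := norm_add_le (T (v - w) v) (T w (v - w))
  nlinarith

/-- Two short solutions of the geodesic equation `u'' = -B(u)(u', u')` that start at the same point
differ at time `1` by approximately the difference of their initial velocities. -/
theorem norm_geodesic_sub_le {B : E → E →L[ℝ] E →L[ℝ] E} {s : Set E} {C a : ℝ}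
    (ha : a ≤ 1) (hCa : 12 * C * a ≤ 1)
    (hB : ∀ y ∈ s, ‖B y‖ ≤ C) (hL : ∀ y ∈ s, ∀ y' ∈ s, ‖B y - B y'‖ ≤ C * ‖y - y'‖)
    {u u' v v' : ℝ → E}
    (hu : ∀ t ∈ Set.Icc (0 : ℝ) 1, u t ∈ s ∧ ‖u' t‖ ≤ a ∧ HasDerivAt u (u' t) t ∧
      HasDerivAt u' (-B (u t) (u' t) (u' t)) t)
    (hv : ∀ t ∈ Set.Icc (0 : ℝ) 1, v t ∈ s ∧ ‖v' t‖ ≤ a ∧ HasDerivAt v (v' t) t ∧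
      HasDerivAt v' (-B (v t) (v' t) (v' t)) t)
    (h0 : u 0 = v 0) :
    ‖u 1 - v 1 - (u' 0 - v' 0)‖ ≤ 1 / 2 * ‖u' 0 - v' 0‖ := by
  have z0 : (0 : ℝ) ∈ Set.Icc (0 : ℝ) 1 := by simp
  have z1 : (1 : ℝ) ∈ Set.Icc (0 : ℝ) 1 := by simp
  have ha0 : 0 ≤ a := (norm_nonneg _).trans (hu 0 z0).2.1
  have hC0 : 0 ≤ C := (norm_nonneg (B (u 0))).trans (hB _ (hu 0 z0).1)
  set w : ℝ → E := fun t => u' t - v' t with hw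
  have hwd : ∀ t ∈ Set.Icc (0 : ℝ) 1,
      HasDerivAt w (-B (u t) (u' t) (u' t) - -B (v t) (v' t) (v' t)) t :=
    fun t ht => (hu t ht).2.2.2.sub (hv t ht).2.2.2
  have hwc : ContinuousOn (fun t => ‖w t‖) (Set.Icc 0 1) :=
    fun t ht => (hwd t ht).continuousAt.norm.continuousWithinAt
  -- In place of Gronwall: the largest velocity gap m bounds the position gap, hence also the
  -- acceleration gap by κm with κ ≤ 1/4. This is absorbed into m and leaves m ≤ 2‖w 0‖.
  obtain ⟨τ, hτ, hmax⟩ := isCompact_Icc.exists_isMaxOn ⟨0, z0⟩ hwc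
  set m := ‖w τ‖ with hm
  have hmax' : ∀ t ∈ Set.Icc (0 : ℝ) 1, ‖w t‖ ≤ m := fun t ht => hmax ht
  have hm0 : 0 ≤ m := norm_nonneg _
  have hδ : ∀ t ∈ Set.Icc (0 : ℝ) 1, ‖u t - v t‖ ≤ m := by
    intro t ht
    have := norm_sub_zero_le_of_hasDerivAt (f := fun t => u t - v t) le_rfl
      (fun t ht => (hu t ht).2.2.1.sub (hv t ht).2.2.1) hmax' ht
    simpa [h0] using this
  set κ := 3 * C * a with hκ
  have hκ1 : κ ≤ 1 / 4 := by rw [hκ]; linarith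
  have hacc : ∀ t ∈ Set.Icc (0 : ℝ) 1,
      ‖-B (u t) (u' t) (u' t) - -B (v t) (v' t) (v' t)‖ ≤ κ * m := by
    intro t ht
    rw [neg_sub_neg, norm_sub_rev]
    refine (norm_quadratic_sub_le _ _ (hu t ht).2.1 (hv t ht).2.1
      ((hL _ (hu t ht).1 _ (hv t ht).1).trans (mul_le_mul_of_nonneg_left (hδ t ht) hC0))
      (hB _ (hv t ht).1)).trans ?_
    have h1 := hmax' t ht
    have h2 : 2 * C * a * ‖u' t - v' t‖ ≤ 2 * C * a * m := by gcongr
    have h3 : C * m * a ^ 2 ≤ C * m * a := by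
      have : a ^ 2 ≤ a := by nlinarith
      gcongr
    rw [hκ]; linarith
  have hwt : ∀ t ∈ Set.Icc (0 : ℝ) 1, ‖w t - w 0‖ ≤ κ * m :=
    fun t ht => norm_sub_zero_le_of_hasDerivAt le_rfl hwd hacc ht
  have hmw : m ≤ 2 * ‖w 0‖ := by
    have h1 : m ≤ ‖w τ - w 0‖ + ‖w 0‖ := by
      simpa using norm_add_le (w τ - w 0) (w 0)
    have h2 := hwt τ hτ
    have h3 : κ * m ≤ 1 / 4 * m := by gcongr
    linarith
  have hfin := norm_sub_zero_le_of_hasDerivAt (f := fun t => u t - v t - t • w 0)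
    (f' := fun t => w t - w 0) (C := κ * m) le_rfl
    (fun t ht => by
      have := ((hu t ht).2.2.1.sub (hv t ht).2.2.1).sub ((hasDerivAt_id t).smul_const (w 0))
      rw [one_smul] at this
      exact this) hwt z1
  have h4 : κ * m ≤ 1 / 4 * (2 * ‖w 0‖) := by gcongr
  simp only [h0, sub_self, zero_smul, sub_zero, one_smul] at hfin
  linarith

end ODE

/-! ### The geodesic equation of a metric tensor on a vector space. -/

section TrilinearForms

variable {E : Type*} [NormedAddCommGroup E] [NormedSpace ℝ E]

local instance : NormedAddCommGroup (E →L[ℝ] E →L[ℝ] ℝ) := inferInstance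
local instance : NormedSpace ℝ (E →L[ℝ] E →L[ℝ] ℝ) := inferInstance
local instance : NormedAddCommGroup ((E →L[ℝ] ℝ) →L[ℝ] E) := inferInstance
local instance : NormedSpace ℝ ((E →L[ℝ] ℝ) →L[ℝ] E) := inferInstance
local instance : NormedAddCommGroup (E →L[ℝ] E →L[ℝ] E) := inferInstance
local instance : NormedSpace ℝ (E →L[ℝ] E →L[ℝ] E) := inferInstance
local instance : NormedAddCommGroup ((E →L[ℝ] E →L[ℝ] ℝ) →L[ℝ] E →L[ℝ] E) := inferInstance
local instance : NormedSpace ℝ ((E →L[ℝ] E →L[ℝ] ℝ) →L[ℝ] E →L[ℝ] E) := inferInstance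
local instance : NormedAddCommGroup (E →L[ℝ] E →L[ℝ] E →L[ℝ] ℝ) := inferInstance
local instance : NormedSpace ℝ (E →L[ℝ] E →L[ℝ] E →L[ℝ] ℝ) := inferInstance

/-- The permutation `(a, b, c) ↦ D(c, a, b)` of the arguments of a trilinear form. -/
def permForm : (E →L[ℝ] E →L[ℝ] E →L[ℝ] ℝ) →L[ℝ] (E →L[ℝ] E →L[ℝ] E →L[ℝ] ℝ) :=
  (ContinuousLinearMap.compL ℝ E (E →L[ℝ] E →L[ℝ] ℝ) (E →L[ℝ] E →L[ℝ] ℝ)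
      ((ContinuousLinearMap.flipₗᵢ ℝ E E ℝ).toContinuousLinearEquiv : _ →L[ℝ] _)).comp
    ((ContinuousLinearMap.flipₗᵢ ℝ E E (E →L[ℝ] ℝ)).toContinuousLinearEquiv : _ →L[ℝ] _)

theorem permForm_apply (D : E →L[ℝ] E →L[ℝ] E →L[ℝ] ℝ) (a b c : E) :
    permForm D a b c = D c a b := by
  simp [permForm]

set_option synthInstance.maxHeartbeats 200000 in
/-- The trilinear form `(a, b, c) ↦ D(a, b, c) - ½ D(c, a, b)`. -/
def christoffelForm : (E →L[ℝ] E →L[ℝ] E →L[ℝ] ℝ) →L[ℝ] (E →L[ℝ] E →L[ℝ] E →L[ℝ] ℝ) :=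
  ContinuousLinearMap.id ℝ (E →L[ℝ] E →L[ℝ] E →L[ℝ] ℝ) - (1 / 2 : ℝ) • permForm (E := E)

set_option synthInstance.maxHeartbeats 200000 in
theorem christoffelForm_apply (D : E →L[ℝ] E →L[ℝ] E →L[ℝ] ℝ) (a b c : E) :
    christoffelForm D a b c = D a b c - 1 / 2 * D c a b := by
  simp [christoffelForm, permForm_apply]

/-- The quadratic map `u'' = -B(u', u')` of the geodesic equation of a metric tensor `G`. -/
def sprayForm (G : E → E →L[ℝ] E →L[ℝ] ℝ) (y : E) : E →L[ℝ] E →L[ℝ] E :=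
  (ContinuousLinearMap.compL ℝ E (E →L[ℝ] ℝ) E (G y).inverse).comp
    (christoffelForm (fderiv ℝ G y))

theorem sprayForm_apply (G : E → E →L[ℝ] E →L[ℝ] ℝ) (y a b : E) :
    sprayForm G y a b = (G y).inverse (christoffelForm (fderiv ℝ G y) a b) := rfl

/-- Positivity on the diagonal forces injectivity, and a space and its dual have the same dimension.
-/
theorem isInvertible_of_pos [FiniteDimensional ℝ E] {G : E →L[ℝ] E →L[ℝ] ℝ}
    (hG : ∀ h, h ≠ 0 → 0 < G h h) : G.IsInvertible := by
  have hinj : Function.Injective (G : E →ₗ[ℝ] E →L[ℝ] ℝ) := by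
    rw [← LinearMap.ker_eq_bot, LinearMap.ker_eq_bot']
    intro h hh
    by_contra hne
    have h1 := hG h hne
    have h2 : G h = 0 := hh
    simp [h2] at h1
  have hdim : Module.finrank ℝ E = Module.finrank ℝ (E →L[ℝ] ℝ) := by
    rw [← (LinearMap.toContinuousLinearMap (𝕜 := ℝ) (E := E) (F' := ℝ)).finrank_eq]
    exact (Subspace.dual_finrank_eq (K := ℝ) (V := E)).symm
  refine ⟨(LinearMap.linearEquivOfInjective _ hinj hdim).toContinuousLinearEquiv, ?_⟩
  ext a b
  rfl

/-- Inversion is smooth at invertible maps, and the derivative of the metric costs one order. The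
result C¹ is what gives the local Lipschitz bound on the geodesic equation. -/
theorem contDiffAt_sprayForm [CompleteSpace E] {G : E → E →L[ℝ] E →L[ℝ] ℝ} {y : E}
    (hG : ContDiffAt ℝ 2 G y) (hinv : (G y).IsInvertible) : ContDiffAt ℝ 1 (sprayForm G) y := by
  have h1 : ContDiffAt ℝ 1 (fun y => (G y).inverse) y :=
    hinv.contDiffAt_map_inverse.comp y (hG.of_le (by norm_num))
  have h2 : ContDiffAt ℝ 1 (fun y => christoffelForm (fderiv ℝ G y)) y :=
    (christoffelForm (E := E)).contDiff.contDiffAt.comp y (hG.fderiv_right (m := 1) (by norm_num))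
  have h3 := (ContinuousLinearMap.compL ℝ E (E →L[ℝ] ℝ) E).contDiff.contDiffAt.comp (n := 1) y h1
  exact h3.clm_comp h2

theorem eq_neg_sprayForm {G : E → E →L[ℝ] E →L[ℝ] ℝ} {y a h : E} (hinv : (G y).IsInvertible)
    (heq : ∀ c, G y h c + christoffelForm (fderiv ℝ G y) a a c = 0) :
    h = -sprayForm G y a a := by
  have h1 : G y h = -christoffelForm (fderiv ℝ G y) a a := by
    ext c
    have := heq c
    simp only [_root_.neg_apply]
    linarith
  obtain ⟨L, hL⟩ := hinv
  rw [sprayForm_apply, ← map_neg, ← h1, ← hL, ContinuousLinearMap.inverse_equiv]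
  simp

/-- Near a point where the metric tensor is positive definite, its inverse and the geodesic equation
have uniform bounds. -/
theorem exists_sprayForm_bounds [FiniteDimensional ℝ E] {G : E → E →L[ℝ] E →L[ℝ] ℝ} {U : Set E}
    {y₀ : E} (hU : U ∈ 𝓝 y₀) (hsm : ContDiffAt ℝ 2 G y₀) {c : ℝ} (hc : 0 < c)
    (hlow : ∀ a, c * ‖a‖ ^ 2 ≤ G y₀ a a) :
    ∃ r : ℝ, 0 < r ∧ ∃ L : ℝ, 1 ≤ L ∧ Metric.closedBall y₀ r ⊆ U ∧
      (∀ y ∈ Metric.closedBall y₀ r, (∀ a, ‖a‖ ^ 2 ≤ L * G y a a) ∧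
        (∀ a, G y a a ≤ L * ‖a‖ ^ 2) ∧ (G y).IsInvertible ∧ ‖sprayForm G y‖ ≤ L) ∧
      ∀ y ∈ Metric.closedBall y₀ r, ∀ y' ∈ Metric.closedBall y₀ r,
        ‖sprayForm G y - sprayForm G y'‖ ≤ L * ‖y - y'‖ := by
  have : CompleteSpace E := FiniteDimensional.complete ℝ E
  have hpos : ∀ y, (∀ a, c / 2 * ‖a‖ ^ 2 ≤ G y a a) → (G y).IsInvertible := fun y h =>
    isInvertible_of_pos fun a ha => lt_of_lt_of_le (by positivity) (h a)
  have hinv : (G y₀).IsInvertible := hpos _ fun a =>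
    le_trans (by nlinarith [sq_nonneg ‖a‖]) (hlow a)
  have hS := contDiffAt_sprayForm hsm hinv
  obtain ⟨K, t, ht, hK⟩ := hS.exists_lipschitzOnWith
  -- A perturbation of `G y₀` by less than c/2 keeps half of the lower bound.
  have hnear : ∀ᶠ y in 𝓝 y₀, dist (G y) (G y₀) < c / 2 :=
    hsm.continuousAt.eventually (Metric.ball_mem_nhds _ (half_pos hc))
  have hSn : ∀ᶠ y in 𝓝 y₀, dist (sprayForm G y) (sprayForm G y₀) < 1 :=
    hS.continuousAt.eventually (Metric.ball_mem_nhds _ one_pos)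
  obtain ⟨r, hr, hball⟩ := Metric.nhds_basis_closedBall.mem_iff.1
    (Filter.inter_mem (Filter.inter_mem hU ht) (Filter.inter_mem hnear hSn))
  set T : ℝ := ‖G y₀‖ + c / 2 with hT
  have hG0 := norm_nonneg (G y₀)
  have hGn : ∀ y ∈ Metric.closedBall y₀ r, ‖G y - G y₀‖ ≤ c / 2 := by
    intro y hy
    have h1 : dist (G y) (G y₀) < c / 2 := (hball hy).2.1
    rw [dist_eq_norm] at h1
    exact h1.le
  have hlow' : ∀ y ∈ Metric.closedBall y₀ r, ∀ a, c / 2 * ‖a‖ ^ 2 ≤ G y a a := by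
    intro y hy a
    have h1 : ‖(G y - G y₀) a a‖ ≤ c / 2 * ‖a‖ * ‖a‖ :=
      ((G y - G y₀).le_opNorm₂ a a).trans (by gcongr; exact hGn y hy)
    have h2 := hlow a
    rw [_root_.sub_apply, _root_.sub_apply, Real.norm_eq_abs, abs_le] at h1
    nlinarith [h1.1]
  have hup : ∀ y ∈ Metric.closedBall y₀ r, ∀ a, G y a a ≤ T * ‖a‖ ^ 2 := by
    intro y hy a
    have h1 : ‖G y‖ ≤ T := by
      have h3 := norm_add_le (G y - G y₀) (G y₀)
      rw [sub_add_cancel] at h3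
      have := hGn y hy
      linarith
    have h2 : ‖G y a a‖ ≤ T * ‖a‖ * ‖a‖ := ((G y).le_opNorm₂ a a).trans (by gcongr)
    have := le_abs_self (G y a a)
    rw [Real.norm_eq_abs] at h2
    nlinarith
  -- One summand for each bound: L ≥ 1, Lipschitz, norm of the spray, upper and lower bound of the
  -- metric.
  set L : ℝ := 1 + K + (‖sprayForm G y₀‖ + 1) + T + 2 / c with hL
  have hT0 : 0 < T := by positivity
  have hS0 := norm_nonneg (sprayForm G y₀)
  have hK0 : (0 : ℝ) ≤ K := K.2
  have hc2 : 0 < 2 / c := by positivity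
  refine ⟨r, hr, L, by linarith, fun y hy => (hball hy).1.1, fun y hy => ⟨fun a => ?_, fun a => ?_,
    hpos y (hlow' y hy), ?_⟩, fun y hy y' hy' => ?_⟩
  · have h := hlow' y hy a
    have hG : 0 ≤ G y a a := le_trans (by positivity) h
    have h2 : ‖a‖ ^ 2 ≤ 2 / c * G y a a := by
      rw [div_mul_eq_mul_div, le_div_iff₀ hc]; linarith
    have h3 : 2 / c * G y a a ≤ L * G y a a := mul_le_mul_of_nonneg_right (by linarith) hG
    linarith
  · exact (hup y hy a).trans (mul_le_mul_of_nonneg_right (by linarith) (by positivity))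
  · have h1 : dist (sprayForm G y) (sprayForm G y₀) < 1 := (hball hy).2.2
    rw [dist_eq_norm] at h1
    have h3 := norm_add_le (sprayForm G y - sprayForm G y₀) (sprayForm G y₀)
    rw [sub_add_cancel] at h3
    linarith
  · exact (hK.norm_sub_le (hball hy).1.2 (hball hy').1.2).trans
      (mul_le_mul_of_nonneg_right (by linarith) (norm_nonneg _))

end TrilinearForms

/-! ### The metric tensor in a chart and its smoothness. -/

section ChartMetric

variable {d : ℕ} {M : Type*} [MetricSpace M] [ChartedSpace (EuclideanSpace ℝ (Fin d)) M]

local notation "𝔼(" d ")" => EuclideanSpace ℝ (Fin d)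

/-- The tangent vector with coordinates `a` at the point with coordinates `y` in the chart `e`. -/
def chartPush (e : OpenPartialHomeomorph M 𝔼(d)) (y : 𝔼(d)) :
    𝔼(d) →L[ℝ] TangentSpace (𝓡 d) (e.symm y) :=
  mfderiv (𝓡 d) (𝓡 d) e.symm y

/-- The coordinates of the tangent vector `w` at the point `x` in the chart `e`. -/
def chartCoord (e : OpenPartialHomeomorph M 𝔼(d)) (x : M) :
    TangentSpace (𝓡 d) x →L[ℝ] 𝔼(d) :=
  mfderiv (𝓡 d) (𝓡 d) e x

variable [Bundle.RiemannianBundle (fun x : M => TangentSpace (𝓡 d) x)]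

theorem chartMetric_eq (e : OpenPartialHomeomorph M 𝔼(d)) (y a b : 𝔼(d)) :
    chartMetric e y a b = inner ℝ (chartPush e y a) (chartPush e y b) := rfl

/-- The metric tensor in the chart `e`, as a continuous bilinear form. -/
def chartMetricForm (e : OpenPartialHomeomorph M 𝔼(d)) (y : 𝔼(d)) : 𝔼(d) →L[ℝ] 𝔼(d) →L[ℝ] ℝ :=
  LinearMap.toContinuousBilinearMap
    (LinearMap.mk₂ ℝ (fun a b => chartMetric e y a b)
      (fun a a' b => by simp only [chartMetric_eq, map_add, inner_add_left])
      (fun c a b => by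
        simp only [chartMetric_eq, map_smul, real_inner_smul_left, smul_eq_mul])
      (fun a b b' => by simp only [chartMetric_eq, map_add, inner_add_right])
      (fun c a b => by
        simp only [chartMetric_eq, map_smul, real_inner_smul_right, smul_eq_mul]))

theorem chartMetricForm_apply (e : OpenPartialHomeomorph M 𝔼(d)) (y a b : 𝔼(d)) :
    chartMetricForm e y a b = chartMetric e y a b := rfl

theorem chartMetric_self (e : OpenPartialHomeomorph M 𝔼(d)) (y a : 𝔼(d)) :
    chartMetric e y a a = ‖chartPush e y a‖ ^ 2 := by
  rw [chartMetric_eq, real_inner_self_eq_norm_sq]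

variable [IsManifold (𝓡 d) ∞ M]

theorem norm_chartPush_chartCoord {e : OpenPartialHomeomorph M 𝔼(d)} (he : e ∈ atlas 𝔼(d) M)
    {x : M} (hx : x ∈ e.source) (w : TangentSpace (𝓡 d) x) :
    ‖chartPush e (e x) (chartCoord e x w)‖ = ‖w‖ := by
  have := IsManifold.of_le (I := 𝓡 d) (M := M) (m := 1) (n := ∞) (by simp)
  have h : (chartPush e (e x) (chartCoord e x w) : 𝔼(d)) = w :=
    congrArg (fun L => L w) ((mdifferentiable_of_mem_atlas (I := 𝓡 d) he).symm_comp_deriv hx)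
  -- The two vectors live over `e.symm (e x)` and `x`, and the norm depends on the base point; the
  -- equality of base points is used to transport it.
  have key : ∀ (x' : M) (_ : x' = x) (v : TangentSpace (𝓡 d) x') (w : TangentSpace (𝓡 d) x),
      (show 𝔼(d) from v) = (show 𝔼(d) from w) → ‖v‖ = ‖w‖ := by
    intro x' hx' v w h
    subst hx'
    exact congrArg (fun u : TangentSpace (𝓡 d) x' => ‖u‖) h
  exact key _ (e.left_inv hx) _ _ h

/-- Constant coordinate fields are pushed by the tangent map of `e.symm` to smooth fields, whose
inner product is smooth because the bundle metric is. -/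
theorem contDiffOn_chartMetric [IsContMDiffRiemannianBundle (𝓡 d) ∞ 𝔼(d)
      (fun x : M => TangentSpace (𝓡 d) x)] {e : OpenPartialHomeomorph M 𝔼(d)}
    (he : e ∈ atlas 𝔼(d) M) (a b : 𝔼(d)) :
    ContDiffOn ℝ ∞ (fun y => chartMetric e y a b) e.target := by
  have hsymm : ContMDiffOn (𝓡 d) (𝓡 d) ∞ e.symm e.target :=
    contMDiffOn_symm_of_mem_maximalAtlas
      (StructureGroupoid.subset_maximalAtlas _ he)
  have key : ∀ a : 𝔼(d), ContMDiffOn (𝓡 d) ((𝓡 d).prod 𝓘(ℝ, 𝔼(d))) ∞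
      (fun y => (⟨e.symm y, mfderiv (𝓡 d) (𝓡 d) e.symm y a⟩ : TangentBundle (𝓡 d) M)) e.target := by
    intro a
    have h1 := hsymm.contMDiffOn_tangentMapWithin (m := ∞) (by simp) e.open_target.uniqueMDiffOn
    have h2 : ContMDiff (𝓡 d) ((𝓡 d).prod 𝓘(ℝ, 𝔼(d))) ∞
        (fun y : 𝔼(d) => (⟨y, a⟩ : TangentBundle (𝓡 d) 𝔼(d))) :=
      contMDiff_vectorSpace_iff_contDiff.2 contDiff_const
    have h3 := h1.comp h2.contMDiffOn (s := e.target) (fun y hy => hy)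
    refine h3.congr fun y hy => ?_
    simp [tangentMapWithin, mfderivWithin_of_isOpen e.open_target hy]
  have := ContMDiffOn.inner_bundle (key a) (key b)
  rw [contMDiffOn_iff_contDiffOn] at this
  exact this

theorem contDiffOn_chartMetricForm [IsContMDiffRiemannianBundle (𝓡 d) ∞ 𝔼(d)
      (fun x : M => TangentSpace (𝓡 d) x)] {e : OpenPartialHomeomorph M 𝔼(d)}
    (he : e ∈ atlas 𝔼(d) M) : ContDiffOn ℝ ∞ (chartMetricForm e) e.target := by
  rw [contDiffOn_clm_apply]
  intro a
  rw [contDiffOn_clm_apply]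
  intro b
  exact contDiffOn_chartMetric he a b

end ChartMetric

section Christoffel

variable {d : ℕ} {M : Type*} [MetricSpace M] [ChartedSpace (EuclideanSpace ℝ (Fin d)) M]
  [Bundle.RiemannianBundle (fun x : M => TangentSpace (𝓡 d) x)]

local notation "𝔼(" d ")" => EuclideanSpace ℝ (Fin d)

theorem chartMetricDeriv_eq {e : OpenPartialHomeomorph M 𝔼(d)} {y : 𝔼(d)}
    (h : DifferentiableAt ℝ (chartMetricForm e) y) (c a b : 𝔼(d)) :
    chartMetricDeriv e y c a b = fderiv ℝ (chartMetricForm e) y c a b := by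
  have h1 := (h.hasFDerivAt.clm_apply (hasFDerivAt_const a y)).clm_apply (hasFDerivAt_const b y)
  have : (fun y' => chartMetric e y' a b) = fun y' => chartMetricForm e y' a b := rfl
  rw [chartMetricDeriv, this, h1.fderiv]
  simp

/-- On the diagonal the first two terms of the Christoffel symbol coincide, so the form without
symmetrization suffices: the geodesic equation only evaluates it at (u', u'). -/
theorem christoffel_self {e : OpenPartialHomeomorph M 𝔼(d)} {y : 𝔼(d)}
    (h : DifferentiableAt ℝ (chartMetricForm e) y) (a c : 𝔼(d)) :
    christoffel e y a a c = christoffelForm (fderiv ℝ (chartMetricForm e) y) a a c := by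
  rw [christoffelForm_apply, christoffel]
  simp only [chartMetricDeriv_eq h]
  ring

end Christoffel

/-! ### Uniform bounds in a chart near a point. -/

section ChartBounds

variable {d : ℕ} {M : Type*} [MetricSpace M] [ChartedSpace (EuclideanSpace ℝ (Fin d)) M]
  [Bundle.RiemannianBundle (fun x : M => TangentSpace (𝓡 d) x)]

local notation "𝔼(" d ")" => EuclideanSpace ℝ (Fin d)

/-- Uniform bounds for the metric tensor and the geodesic equation in the chart `e`, on the
set `s` of coordinate vectors. -/
structure ChartBounds (e : OpenPartialHomeomorph M 𝔼(d)) (s : Set 𝔼(d)) (L : ℝ) : Prop where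
  mem_atlas : e ∈ atlas 𝔼(d) M
  one_le : 1 ≤ L
  subset_target : s ⊆ e.target
  le_norm_push : ∀ y ∈ s, ∀ a, ‖a‖ ≤ L * ‖chartPush e y a‖
  norm_push_le : ∀ y ∈ s, ∀ a, ‖chartPush e y a‖ ≤ L * ‖a‖
  norm_spray_le : ∀ y ∈ s, ‖sprayForm (chartMetricForm e) y‖ ≤ L
  norm_spray_sub_le : ∀ y ∈ s, ∀ y' ∈ s,
    ‖sprayForm (chartMetricForm e) y - sprayForm (chartMetricForm e) y'‖ ≤ L * ‖y - y'‖
  geodesic : ∀ y ∈ s, ∀ a h, (∀ c, chartMetric e y h c + christoffel e y a a c = 0) →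
    h = -sprayForm (chartMetricForm e) y a a

variable [IsManifold (𝓡 d) ∞ M]

/-- Every coordinate vector is the image of a tangent vector under the differential of the chart, so
the operator norm of this differential controls the lower bound. The summand 1 only makes C
positive. -/
theorem norm_sq_le_chartMetric {e : OpenPartialHomeomorph M 𝔼(d)} (he : e ∈ atlas 𝔼(d) M)
    {x : M} (hx : x ∈ e.source) :
    ∃ c : ℝ, 0 < c ∧ ∀ a, c * ‖a‖ ^ 2 ≤ chartMetric e (e x) a a := by
  have := IsManifold.of_le (I := 𝓡 d) (M := M) (m := 1) (n := ∞) (by simp)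
  set C := ‖chartCoord e x‖ + 1 with hC
  have hC0 : 0 < C := by positivity
  refine ⟨(C ^ 2)⁻¹, by positivity, fun a => ?_⟩
  obtain ⟨w, rfl⟩ : ∃ w, chartCoord e x w = a :=
    ((mdifferentiable_of_mem_atlas (I := 𝓡 d) he).mfderiv_surjective hx) a
  rw [chartMetric_self, norm_chartPush_chartCoord he hx, inv_mul_le_iff₀ (by positivity),
    ← mul_pow]
  gcongr
  refine ((chartCoord e x).le_opNorm w).trans ?_
  gcongr
  linarith

theorem exists_chartBounds [IsContMDiffRiemannianBundle (𝓡 d) ∞ 𝔼(d)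
      (fun x : M => TangentSpace (𝓡 d) x)] (z : M) :
    ∃ r : ℝ, 0 < r ∧ ∃ L,
      ChartBounds (chartAt 𝔼(d) z) (Metric.closedBall (chartAt 𝔼(d) z z) r) L := by
  set e := chartAt 𝔼(d) z with he
  have heA : e ∈ atlas 𝔼(d) M := chart_mem_atlas _ _
  have hz : z ∈ e.source := mem_chart_source _ _
  have hy : e z ∈ e.target := e.map_source hz
  obtain ⟨c, hc, hlow⟩ := norm_sq_le_chartMetric heA hz
  have hsm : ∀ y ∈ e.target, ContDiffAt ℝ ∞ (chartMetricForm e) y := fun y hy =>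
    (contDiffOn_chartMetricForm heA).contDiffAt (e.open_target.mem_nhds hy)
  obtain ⟨r, hr, L, hL, hsub, hb, hlip⟩ := exists_sprayForm_bounds (e.open_target.mem_nhds hy)
    ((hsm _ hy).of_le ENat.LEInfty.out) hc hlow
  -- The bounds on the quadratic form have constant L; those on norms, once squared, need L².
  have hL2 : L ≤ L ^ 2 := by nlinarith
  refine ⟨r, hr, L, heA, hL, hsub, ?_, ?_, fun y hy => (hb y hy).2.2.2, hlip, ?_⟩
  · intro y hy a
    have h := (hb y hy).1 a
    rw [chartMetricForm_apply, chartMetric_self] at h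
    refine le_of_sq_le_sq (h.trans ?_) (by positivity)
    rw [mul_pow]
    gcongr
  · intro y hy a
    have h := (hb y hy).2.1 a
    rw [chartMetricForm_apply, chartMetric_self] at h
    refine le_of_sq_le_sq (h.trans ?_) (by positivity)
    rw [mul_pow]
    gcongr
  · intro y hy a h heq
    refine eq_neg_sprayForm (hb y hy).2.2.1 fun c => ?_
    rw [← christoffel_self ((hsm y (hsub hy)).differentiableAt (by simp))]
    exact heq c

end ChartBounds

/-! ### Comparison of Riemannian and coordinate distance. -/

section Paths

variable {d : ℕ} {M : Type*} [MetricSpace M] [ChartedSpace (EuclideanSpace ℝ (Fin d)) M]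
  [Bundle.RiemannianBundle (fun x : M => TangentSpace (𝓡 d) x)]
  [IsManifold (𝓡 d) ∞ M] [IsRiemannianManifold (𝓡 d) M]

local notation "𝔼(" d ")" => EuclideanSpace ℝ (Fin d)

/-- The mean value inequality on a ball of a Riemannian manifold: paths that are almost as short as
the distance to the center stay in the ball. -/
theorem norm_sub_le_mul_dist {F : Type*} [NormedAddCommGroup F] [NormedSpace ℝ F] {f : M → F}
    {z : M} {ρ C : ℝ} (hC0 : 0 ≤ C)
    (hf : ContMDiffOn (𝓡 d) 𝓘(ℝ, F) 1 f (Metric.ball z ρ))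
    (hC : ∀ x ∈ Metric.ball z ρ, ∀ w : TangentSpace (𝓡 d) x,
      ‖(show F from mfderiv (𝓡 d) 𝓘(ℝ, F) f x w)‖ ≤ C * ‖w‖)
    {x : M} (hx : x ∈ Metric.ball z ρ) : ‖f x - f z‖ ≤ C * dist x z := by
  have := IsManifold.of_le (I := 𝓡 d) (M := M) (m := 1) (n := ∞) (by simp)
  have main : ∀ l : ℝ, dist x z < l → l < ρ → ‖f x - f z‖ ≤ C * l := by
    intro l hl hlρ
    have hl0 : 0 < l := dist_nonneg.trans_lt hl
    have h1 : Manifold.riemannianEDist (𝓡 d) z x < ENNReal.ofReal l := by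
      rw [← IsRiemannianManifold.out (I := 𝓡 d), edist_dist, dist_comm]
      exact (ENNReal.ofReal_lt_ofReal_iff hl0).2 hl
    obtain ⟨γ, hγ0, hγ1, hγ, hlen, -, -⟩ :=
      Manifold.exists_lt_locally_constant_of_riemannianEDist_lt h1 zero_lt_one
    -- The path starts at the center, so the length of its initial arc bounds the distance of γ t
    -- from z.
    have hmem : ∀ t ∈ Set.Icc (0 : ℝ) 1, γ t ∈ Metric.ball z ρ := by
      intro t ht
      have h2 : edist z (γ t) ≤ ENNReal.ofReal l := by
        rw [IsRiemannianManifold.out (I := 𝓡 d)]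
        exact (Manifold.riemannianEDist_le_pathELength hγ.contMDiffOn hγ0 rfl ht.1).trans
          ((Manifold.pathELength_mono le_rfl ht.2).trans hlen.le)
      rw [edist_dist, ENNReal.ofReal_le_ofReal_iff hl0.le] at h2
      rw [Metric.mem_ball, dist_comm]
      linarith
    have hfat : ∀ t ∈ Set.Icc (0 : ℝ) 1, ContMDiffAt (𝓡 d) 𝓘(ℝ, F) 1 f (γ t) := fun t ht =>
      hf.contMDiffAt (Metric.isOpen_ball.mem_nhds (hmem t ht))
    have hcd : ContDiffOn ℝ 1 (f ∘ γ) (Set.Icc 0 1) := by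
      rw [← contMDiffOn_iff_contDiffOn]
      exact fun t ht => ((hfat t ht).comp t hγ.contMDiffAt).contMDiffWithinAt
    have hint := enorm_sub_le_lintegral_deriv_of_contDiffOn_Icc hcd zero_le_one
    have hbd : ∫⁻ t in Set.Icc (0 : ℝ) 1, ‖deriv (f ∘ γ) t‖ₑ ≤
        ENNReal.ofReal C * Manifold.pathELength (𝓡 d) γ 0 1 := by
      rw [Manifold.pathELength_eq_lintegral_mfderiv_Icc,
        ← MeasureTheory.lintegral_const_mul' _ _ ENNReal.ofReal_ne_top]
      refine MeasureTheory.setLIntegral_mono' measurableSet_Icc fun t ht => ?_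
      have hd : deriv (f ∘ γ) t =
          (show F from mfderiv (𝓡 d) 𝓘(ℝ, F) f (γ t)
            (mfderiv 𝓘(ℝ, ℝ) (𝓡 d) γ t (1 : ℝ))) := by
        have h3 := mfderiv_comp t ((hfat t ht).mdifferentiableAt one_ne_zero)
          ((hγ.contMDiffAt (x := t)).mdifferentiableAt one_ne_zero)
        rw [mfderiv_eq_fderiv] at h3
        exact congrArg (fun T => T (1 : ℝ)) h3
      rw [hd, ← ofReal_norm, ← ofReal_norm, ← ENNReal.ofReal_mul hC0]
      exact ENNReal.ofReal_le_ofReal (hC _ (hmem t ht) _)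
    have hfin : ‖f x - f z‖ₑ ≤ ENNReal.ofReal (C * l) := by
      rw [ENNReal.ofReal_mul hC0]
      simp only [Function.comp_apply, hγ0, hγ1] at hint
      refine hint.trans (hbd.trans ?_)
      gcongr
    rwa [← ofReal_norm, ENNReal.ofReal_le_ofReal_iff (by positivity)] at hfin
  have hlim : Filter.Tendsto (fun l => C * l) (𝓝[>] dist x z) (𝓝 (C * dist x z)) :=
    ((continuous_const.mul continuous_id).tendsto _).mono_left nhdsWithin_le_nhds
  refine ge_of_tendsto hlim ?_
  filter_upwards [Ioo_mem_nhdsGT (Metric.mem_ball.1 hx)] with l hl using main l hl.1 hl.2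

/-- The image of the coordinate segment is a path of length at most L‖y - y'‖; convexity keeps the
segment where the bounds hold. -/
theorem dist_symm_le {e : OpenPartialHomeomorph M 𝔼(d)} {s : Set 𝔼(d)} {L : ℝ}
    (h : ChartBounds e s L) (hs : Convex ℝ s) {y y' : 𝔼(d)} (hy : y ∈ s) (hy' : y' ∈ s) :
    dist (e.symm y) (e.symm y') ≤ L * ‖y - y'‖ := by
  have := IsManifold.of_le (I := 𝓡 d) (M := M) (m := 1) (n := ∞) (by simp)
  have hL0 : 0 ≤ L := zero_le_one.trans h.one_le
  set γ : ℝ → 𝔼(d) := fun t => AffineMap.lineMap y y' t with hγ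
  have hγs : ∀ t ∈ Set.Icc (0 : ℝ) 1, γ t ∈ s := fun t ht =>
    hs.lineMap_mem hy hy' ht
  have hγd : ∀ t, HasDerivAt γ (y' - y) t := fun t => AffineMap.hasDerivAt_lineMap
  have hγc : ContDiff ℝ 1 γ := by
    simp only [hγ, AffineMap.lineMap_apply, vsub_eq_sub, vadd_eq_add]
    fun_prop
  have hσ : ∀ t ∈ Set.Icc (0 : ℝ) 1, ContMDiffAt (𝓡 d) (𝓡 d) 1 e.symm (γ t) := fun t ht =>
    contMDiffAt_symm_of_mem_maximalAtlas (StructureGroupoid.subset_maximalAtlas _ h.mem_atlas)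
      (h.subset_target (hγs t ht))
  have hc : ContMDiffOn 𝓘(ℝ, ℝ) (𝓡 d) 1 (e.symm ∘ γ) (Set.Icc 0 1) := fun t ht =>
    ((hσ t ht).comp t hγc.contMDiff.contMDiffAt).contMDiffWithinAt
  have h1 := Manifold.riemannianEDist_le_pathELength hc rfl rfl zero_le_one
  have h2 : Manifold.pathELength (𝓡 d) (e.symm ∘ γ) 0 1 ≤ ENNReal.ofReal (L * ‖y - y'‖) := by
    rw [Manifold.pathELength_eq_lintegral_mfderiv_Icc]
    calc _ ≤ ∫⁻ _ in Set.Icc (0 : ℝ) 1, ENNReal.ofReal (L * ‖y - y'‖) := by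
          refine MeasureTheory.setLIntegral_mono' measurableSet_Icc fun t ht => ?_
          have h3 := mfderiv_comp t ((hσ t ht).mdifferentiableAt one_ne_zero)
            ((hγc.contMDiff.contMDiffAt (x := t)).mdifferentiableAt one_ne_zero)
          have h4 : mfderiv 𝓘(ℝ, ℝ) (𝓡 d) (e.symm ∘ γ) t (1 : ℝ) =
              chartPush e (γ t) (y' - y) := by
            rw [h3, mfderiv_eq_fderiv]
            have := (hγd t).deriv
            rw [← fderiv_apply_one_eq_deriv] at this
            exact congrArg (chartPush e (γ t)) this
          have h5 : ‖mfderiv 𝓘(ℝ, ℝ) (𝓡 d) (e.symm ∘ γ) t (1 : ℝ)‖ₑ =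
              ‖chartPush e (γ t) (y' - y)‖ₑ :=
            congrArg (fun w : TangentSpace (𝓡 d) (e.symm (γ t)) => ‖w‖ₑ) h4
          refine h5.trans_le ?_
          rw [← ofReal_norm, norm_sub_rev]
          exact ENNReal.ofReal_le_ofReal (h.norm_push_le _ (hγs t ht) _)
      _ = _ := by simp
  rw [← IsRiemannianManifold.out (I := 𝓡 d)] at h1
  have h3 := h1.trans h2
  simp only [hγ, Function.comp_apply, AffineMap.lineMap_apply_zero, AffineMap.lineMap_apply_one]
    at h3
  rwa [edist_dist, ENNReal.ofReal_le_ofReal_iff (by positivity)] at h3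

end Paths

/-! ### Short geodesics in a chart. -/

section Geodesics

variable {d : ℕ} {M : Type*} [MetricSpace M] [ChartedSpace (EuclideanSpace ℝ (Fin d)) M]
  [Bundle.RiemannianBundle (fun x : M => TangentSpace (𝓡 d) x)]
  [IsManifold (𝓡 d) ∞ M]

local notation "𝔼(" d ")" => EuclideanSpace ℝ (Fin d)

theorem norm_chartCoord_le {e : OpenPartialHomeomorph M 𝔼(d)} {s : Set 𝔼(d)} {L : ℝ}
    (h : ChartBounds e s L) {x : M} (hx : x ∈ e.source) (hxs : e x ∈ s)
    (w : TangentSpace (𝓡 d) x) : ‖chartCoord e x w‖ ≤ L * ‖w‖ := by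
  rw [← norm_chartPush_chartCoord h.mem_atlas hx w]
  exact h.le_norm_push _ hxs _

theorem norm_le_norm_chartCoord {e : OpenPartialHomeomorph M 𝔼(d)} {s : Set 𝔼(d)} {L : ℝ}
    (h : ChartBounds e s L) {x : M} (hx : x ∈ e.source) (hxs : e x ∈ s)
    (w : TangentSpace (𝓡 d) x) : ‖w‖ ≤ L * ‖chartCoord e x w‖ := by
  rw [← norm_chartPush_chartCoord h.mem_atlas hx w]
  exact h.norm_push_le _ hxs _

/-- Counterpart of `dist_symm_le`: the mean value inequality applied to the chart itself. -/
theorem norm_chart_sub_le [IsRiemannianManifold (𝓡 d) M] {e : OpenPartialHomeomorph M 𝔼(d)}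
    {s : Set 𝔼(d)} {L : ℝ} (h : ChartBounds e s L) {z : M} {ρ : ℝ}
    (hρ : ∀ x ∈ Metric.ball z ρ, x ∈ e.source ∧ e x ∈ s) {x : M} (hx : x ∈ Metric.ball z ρ) :
    ‖e x - e z‖ ≤ L * dist x z := by
  refine norm_sub_le_mul_dist (d := d) (zero_le_one.trans h.one_le) ?_ ?_ hx
  · exact (contMDiffOn_of_mem_maximalAtlas (n := 1)
      (IsManifold.maximalAtlas_subset_of_le (n := ∞) (by simp)
        (StructureGroupoid.subset_maximalAtlas _ h.mem_atlas))).mono fun x hx => (hρ x hx).1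
  · exact fun x hx w => norm_chartCoord_le h (hρ x hx).1 (hρ x hx).2 w

theorem IsGeodesicAt.contDiffAt {γ : ℝ → M} {t : ℝ} (hγ : IsGeodesicAt d γ t)
    {e : OpenPartialHomeomorph M 𝔼(d)} (he : e ∈ atlas 𝔼(d) M) (ht : γ t ∈ e.source) :
    ContDiffAt ℝ 2 (e ∘ γ) t := by
  rw [← contMDiffAt_iff_contDiffAt]
  refine ContMDiffAt.comp t ?_ hγ.1
  exact (contMDiffAt_of_mem_maximalAtlas (n := ∞)
    (StructureGroupoid.subset_maximalAtlas _ he) ht).of_le ENat.LEInfty.out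

theorem ContDiffAt.hasDerivAt_deriv {E : Type*} [NormedAddCommGroup E] [NormedSpace ℝ E]
    {u : ℝ → E} {t : ℝ} (hu : ContDiffAt ℝ 2 u t) :
    HasDerivAt u (deriv u t) t ∧ HasDerivAt (deriv u) (deriv (deriv u) t) t :=
  ⟨(hu.differentiableAt (by norm_num)).hasDerivAt,
    (((hu.fderiv_right (m := 1) (by norm_num)).clm_apply contDiffAt_const).differentiableAt
      one_ne_zero).hasDerivAt⟩

theorem IsGeodesicAt.hasDerivAt {γ : ℝ → M} {t : ℝ} (hγ : IsGeodesicAt d γ t)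
    {e : OpenPartialHomeomorph M 𝔼(d)} {s : Set 𝔼(d)} {L : ℝ} (h : ChartBounds e s L)
    (ht : γ t ∈ e.source) (hts : e (γ t) ∈ s) :
    HasDerivAt (e ∘ γ) (deriv (e ∘ γ) t) t ∧ HasDerivAt (deriv (e ∘ γ))
      (-sprayForm (chartMetricForm e) ((e ∘ γ) t) (deriv (e ∘ γ) t) (deriv (e ∘ γ) t)) t := by
  obtain ⟨h1, h2⟩ := ContDiffAt.hasDerivAt_deriv (hγ.contDiffAt h.mem_atlas ht)
  refine ⟨h1, ?_⟩
  have h3 := h.geodesic _ hts _ _ (hγ.2 e h.mem_atlas ht)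
  rw [h3] at h2
  exact h2

/-- A short geodesic stays in the chart, and its velocity at most doubles. -/
theorem geodesic_mem_chart {e : OpenPartialHomeomorph M 𝔼(d)} {y₀ : 𝔼(d)} {r L : ℝ}
    (h : ChartBounds e (Metric.closedBall y₀ r) L) {γ : ℝ → M}
    (hγ : ∀ t ∈ Set.Icc (0 : ℝ) 1, IsGeodesicAt d γ t) (h0 : γ 0 ∈ e.source)
    (h0r : ‖e (γ 0) - y₀‖ ≤ r / 2) {a : ℝ} (ha : 0 < a) (har : 8 * a ≤ r) (haL : 8 * L * a ≤ 1)
    (hv : ‖deriv (e ∘ γ) 0‖ ≤ a) :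
    ∀ t ∈ Set.Icc (0 : ℝ) 1,
      (γ t ∈ e.source ∧ e (γ t) ∈ Metric.closedBall y₀ r) ∧ ‖deriv (e ∘ γ) t‖ ≤ 2 * a := by
  have hL := h.one_le
  -- Compact, hence closed in M: a limit of points of the chart region cannot leave the domain of
  -- the chart.
  set K : Set M := e.symm '' Metric.closedBall y₀ r with hK
  have hKc : IsCompact K := (isCompact_closedBall _ _).image_of_continuousOn
    (e.continuousOn_symm.mono h.subset_target)
  have hKmem : ∀ x, x ∈ K ↔ x ∈ e.source ∧ e x ∈ Metric.closedBall y₀ r := by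
    intro x
    constructor
    · rintro ⟨y, hy, rfl⟩
      exact ⟨e.map_target (h.subset_target hy), by rwa [e.right_inv (h.subset_target hy)]⟩
    · exact fun hx => ⟨e x, hx.2, e.left_inv hx.1⟩
  have hγc : ContinuousOn γ (Set.Icc 0 1) := fun t ht =>
    (hγ t ht).1.continuousAt.continuousWithinAt
  set S : Set ℝ := {t | γ t ∈ K ∧ ‖deriv (e ∘ γ) t‖ ≤ 2 * a} with hS
  have hder : ∀ t ∈ Set.Icc (0 : ℝ) 1, γ t ∈ e.source → ContinuousAt (deriv (e ∘ γ)) t :=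
    fun t ht hs => (ContDiffAt.hasDerivAt_deriv ((hγ t ht).contDiffAt h.mem_atlas hs)).2.continuousAt
  have h0K : γ 0 ∈ K := (hKmem _).2 ⟨h0, by rw [Metric.mem_closedBall, dist_eq_norm]; linarith⟩
  have hSc : IsClosed (S ∩ Set.Icc 0 1) := by
    have h1 : IsClosed (Set.Icc (0 : ℝ) 1 ∩ γ ⁻¹' K) :=
      hγc.preimage_isClosed_of_isClosed isClosed_Icc hKc.isClosed
    have h2 : ContinuousOn (fun t => ‖deriv (e ∘ γ) t‖) (Set.Icc (0 : ℝ) 1 ∩ γ ⁻¹' K) :=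
      fun t ht => (hder t ht.1 ((hKmem _).1 ht.2).1).norm.continuousWithinAt
    have h3 := h2.preimage_isClosed_of_isClosed h1 (isClosed_Iic (a := 2 * a))
    convert h3 using 1
    ext t
    simp only [hS, Set.mem_inter_iff, Set.mem_ofPred_eq, Set.mem_preimage, Set.mem_Iic]
    tauto
  -- Continuous induction: S is closed in [0, 1], and the bounds on [0, t] improve to strict ones at
  -- t, which persist beyond t.
  have main : Set.Icc (0 : ℝ) 1 ⊆ S := by
    refine hSc.Icc_subset_of_forall_mem_nhdsGT_of_Icc_subset ⟨h0K, by linarith⟩ ?_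
    intro t ht hsub
    have htI : t ∈ Set.Icc (0 : ℝ) 1 := ⟨ht.1, ht.2.le⟩
    have htt : t ∈ Set.Icc (0 : ℝ) t := ⟨ht.1, le_rfl⟩
    have hI : ∀ τ ∈ Set.Icc 0 t, τ ∈ Set.Icc (0 : ℝ) 1 := fun τ hτ => ⟨hτ.1, hτ.2.trans ht.2.le⟩
    have hmem : ∀ τ ∈ Set.Icc 0 t, γ τ ∈ e.source ∧ e (γ τ) ∈ Metric.closedBall y₀ r :=
      fun τ hτ => (hKmem _).1 (hsub hτ).1
    have hd : ∀ τ ∈ Set.Icc 0 t, _ := fun τ hτ =>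
      (hγ τ (hI τ hτ)).hasDerivAt h (hmem τ hτ).1 (hmem τ hτ).2
    -- Since 8La ≤ 1, the velocity changes by at most 4La² ≤ a/2, so it stays below 2a. The
    -- displacement is at most 2a ≤ r/4, from a start within r/2 of y₀.
    have hv1 : ‖deriv (e ∘ γ) t - deriv (e ∘ γ) 0‖ ≤ L * (2 * a) * (2 * a) := by
      refine norm_sub_zero_le_of_hasDerivAt ht.2.le (fun τ hτ => (hd τ hτ).2) (fun τ hτ => ?_) htt
      rw [norm_neg]
      refine (ContinuousLinearMap.le_opNorm₂ _ _ _).trans ?_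
      have h1 := h.norm_spray_le _ (hmem τ hτ).2
      have h2 := (hsub hτ).2
      have h3 : 0 ≤ L := by linarith
      exact mul_le_mul (mul_le_mul h1 h2 (norm_nonneg _) h3) h2 (norm_nonneg _) (by positivity)
    have hv2 : ‖deriv (e ∘ γ) t‖ < 2 * a := by
      have h1 := norm_add_le (deriv (e ∘ γ) t - deriv (e ∘ γ) 0) (deriv (e ∘ γ) 0)
      rw [sub_add_cancel] at h1
      nlinarith
    have hu1 : ‖(e ∘ γ) t - (e ∘ γ) 0‖ ≤ 2 * a :=
      norm_sub_zero_le_of_hasDerivAt ht.2.le (fun τ hτ => (hd τ hτ).1)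
        (fun τ hτ => (hsub hτ).2) htt
    have hu2 : e (γ t) ∈ Metric.ball y₀ r := by
      rw [Metric.mem_ball, dist_eq_norm]
      have h1 := norm_add_le ((e ∘ γ) t - (e ∘ γ) 0) (e (γ 0) - y₀)
      simp only [Function.comp_apply, sub_add_sub_cancel] at h1 hu1
      linarith
    have ht1 := (hmem t htt).1
    have hγt : ContinuousAt γ t := (hγ t htI).1.continuousAt
    have e1 : ∀ᶠ τ in 𝓝 t, γ τ ∈ e.source := hγt (e.open_source.mem_nhds ht1)
    have e2 : ∀ᶠ τ in 𝓝 t, e (γ τ) ∈ Metric.ball y₀ r :=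
      ((e.continuousAt ht1).comp hγt) (Metric.isOpen_ball.mem_nhds hu2)
    have e3 : ∀ᶠ τ in 𝓝 t, ‖deriv (e ∘ γ) τ‖ < 2 * a :=
      (hder t htI ht1).norm.eventually_lt continuousAt_const hv2
    refine mem_nhdsWithin_of_mem_nhds ?_
    filter_upwards [e1, e2, e3] with τ h1 h2 h3
    exact ⟨(hKmem _).2 ⟨h1, Metric.ball_subset_closedBall h2⟩, h3.le⟩
  exact fun t ht => ⟨(hKmem _).1 (main ht).1, (main ht).2⟩

/-- In a chart, two short geodesics from the same point are at time `1` separated approximately by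
the difference of their initial velocities. -/
theorem geodesic_chart_sub {e : OpenPartialHomeomorph M 𝔼(d)} {y₀ : 𝔼(d)} {r L : ℝ}
    (h : ChartBounds e (Metric.closedBall y₀ r) L) {x : M} (hx : x ∈ e.source)
    (hxr : ‖e x - y₀‖ ≤ r / 2) {a : ℝ} (ha : 0 < a) (har : 8 * a ≤ r) (haL : 24 * L * a ≤ 1)
    {w w' : TangentSpace (𝓡 d) x} (hw : ‖chartCoord e x w‖ ≤ a) (hw' : ‖chartCoord e x w'‖ ≤ a)
    (hwd : w ∈ expDomain x) (hwd' : w' ∈ expDomain x) :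
    (riemannianExp x w ∈ e.source ∧ e (riemannianExp x w) ∈ Metric.closedBall y₀ r) ∧
      ‖e (riemannianExp x w) - e x‖ ≤ 2 * a ∧
      ‖e (riemannianExp x w) - e (riemannianExp x w') - (chartCoord e x w - chartCoord e x w')‖ ≤
        1 / 2 * ‖chartCoord e x w - chartCoord e x w'‖ := by
  have hL := h.one_le
  have key : ∀ w : TangentSpace (𝓡 d) x, w ∈ expDomain x → ‖chartCoord e x w‖ ≤ a →
      ∃ γ : ℝ → M, riemannianExp x w = γ 1 ∧ γ 0 = x ∧ deriv (e ∘ γ) 0 = chartCoord e x w ∧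
        ∀ t ∈ Set.Icc (0 : ℝ) 1, γ t ∈ e.source ∧ (e ∘ γ) t ∈ Metric.closedBall y₀ r ∧
          ‖deriv (e ∘ γ) t‖ ≤ 2 * a ∧ HasDerivAt (e ∘ γ) (deriv (e ∘ γ) t) t ∧
          HasDerivAt (deriv (e ∘ γ)) (-sprayForm (chartMetricForm e) ((e ∘ γ) t)
            (deriv (e ∘ γ) t) (deriv (e ∘ γ) t)) t := by
    intro w hwd hwa
    have hex : ∃ γ : ℝ → M, IsGeodesicFrom x w γ := hwd
    obtain ⟨⟨ε, hε, hγ⟩, hinit⟩ := hex.choose_spec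
    -- The estimates hold for any geodesic with these initial data, so uniqueness is not needed.
    have hexp : riemannianExp x w = hex.choose 1 := by rw [riemannianExp, dif_pos hex]
    set γ := hex.choose with hγdef
    have hgeo : ∀ t ∈ Set.Icc (0 : ℝ) 1, IsGeodesicAt d γ t := fun t ht =>
      hγ t ⟨by linarith [ht.1], by linarith [ht.2]⟩
    have h0 : γ 0 = x := congrArg Bundle.TotalSpace.proj hinit
    have hz : (0 : ℝ) ∈ Set.Icc (0 : ℝ) 1 := by simp
    have hderiv : deriv (e ∘ γ) 0 = chartCoord e x w := by
      have h1 : MDifferentiableAt (𝓡 d) (𝓡 d) e (γ 0) :=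
        (contMDiffAt_of_mem_maximalAtlas (n := ∞)
          (StructureGroupoid.subset_maximalAtlas _ h.mem_atlas)
          (by rwa [h0])).mdifferentiableAt (by simp)
      have h2 : MDifferentiableAt 𝓘(ℝ, ℝ) (𝓡 d) γ 0 :=
        (hgeo 0 hz).1.mdifferentiableAt (by simp)
      have h3 := mfderiv_comp 0 h1 h2
      rw [mfderiv_eq_fderiv] at h3
      have h4 : deriv (e ∘ γ) 0 =
          chartCoord e (γ 0) (mfderiv 𝓘(ℝ, ℝ) (𝓡 d) γ 0 (1 : ℝ)) :=
        congrArg (fun T => T (1 : ℝ)) h3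
      rw [h4]
      exact congrArg (fun p : TangentBundle (𝓡 d) M => chartCoord e p.proj p.snd) hinit
    have hstay := geodesic_mem_chart h hgeo (by rwa [h0]) (by rwa [h0]) ha har
      (by nlinarith) (by rwa [hderiv])
    refine ⟨γ, hexp, h0, hderiv, fun t ht => ⟨(hstay t ht).1.1, (hstay t ht).1.2,
      (hstay t ht).2, (hgeo t ht).hasDerivAt h (hstay t ht).1.1 (hstay t ht).1.2⟩⟩
  obtain ⟨γ, hγ1, hγ0, hγv, hγ⟩ := key w hwd hw
  obtain ⟨γ', hγ1', hγ0', hγv', hγ'⟩ := key w' hwd' hw'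
  have z1 : (1 : ℝ) ∈ Set.Icc (0 : ℝ) 1 := by simp
  refine ⟨by rw [hγ1]; exact ⟨(hγ 1 z1).1, (hγ 1 z1).2.1⟩, ?_, ?_⟩
  · have := norm_sub_zero_le_of_hasDerivAt le_rfl (fun t ht => (hγ t ht).2.2.2.1)
      (fun t ht => (hγ t ht).2.2.1) z1
    rw [hγ1]
    simpa [hγ0] using this
  · have hLa : a ≤ L * a := le_mul_of_one_le_left ha.le hL
    have h0 : (e ∘ γ) 0 = (e ∘ γ') 0 := by
      rw [Function.comp_apply, Function.comp_apply, hγ0, hγ0']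
    -- Velocities may double, so the smallness condition 12L(2a) ≤ 1 is the hypothesis 24La ≤ 1.
    have h1 := norm_geodesic_sub_le (a := 2 * a) (by linarith) (by linarith) h.norm_spray_le
      h.norm_spray_sub_le (fun t ht => (hγ t ht).2) (fun t ht => (hγ' t ht).2) h0
    rw [hγ1, hγ1', ← hγv, ← hγv']
    exact h1

end Geodesics

/-! ### Balls inside the domain and volume of small balls, locally uniformly. -/

section LocalGeometry

variable {d : ℕ} {M : Type*} [MetricSpace M] [ChartedSpace (EuclideanSpace ℝ (Fin d)) M]
  [Bundle.RiemannianBundle (fun x : M => TangentSpace (𝓡 d) x)]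

local notation "𝔼(" d ")" => EuclideanSpace ℝ (Fin d)

/-- A map that differs from the identity by a contraction maps a ball onto a ball. -/
theorem closedBall_subset_image {E : Type*} [NormedAddCommGroup E] [NormedSpace ℝ E]
    [CompleteSpace E] {F : E → E} {b : E} {ε : ℝ} (hε : 0 ≤ ε)
    (hF : ∀ x ∈ Metric.closedBall b ε, ∀ y ∈ Metric.closedBall b ε,
      ‖F x - F y - (x - y)‖ ≤ 1 / 2 * ‖x - y‖) :
    Metric.closedBall (F b) (ε / 2) ⊆ F '' Metric.closedBall b ε := by
  have h1 : ApproximatesLinearOn F (ContinuousLinearMap.id ℝ E) (Metric.closedBall b ε)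
      (1 / 2) := fun x hx y hy => by simpa using hF x hx y hy
  -- An inverse of norm 1 and a perturbation of size 1/2 give the radius (1⁻¹ - 1/2)ε = ε/2.
  let g : (ContinuousLinearMap.id ℝ E).NonlinearRightInverse :=
    { toFun := id, nnnorm := 1, bound' := by simp, right_inv' := by simp }
  have h2 := h1.surjOn_closedBall_of_nonlinearRightInverse g hε subset_rfl
  have h3 : (((g.nnnorm : NNReal) : ℝ)⁻¹ - ((1 / 2 : NNReal) : ℝ)) * ε = ε / 2 := by
    simp only [g]; push_cast; ring
  rwa [h3] at h2

/-- Near the axis point σv one has ‖w‖ ≤ σ(1 + η) and ⟨v, w⟩ ≥ σ(1 - η), so the condition on η is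
exactly what the cone asks for. -/
theorem mem_tangentCone_of_norm_sub_le {z : M} {rb θ σ η : ℝ} (hσ : 0 < σ)
    (hη1 : η ≤ 1) (hθ0 : 0 ≤ Real.cos θ) (hηθ : Real.cos θ * (1 + η) ≤ 1 - η) (hrb : 2 * σ ≤ rb)
    {v w : TangentSpace (𝓡 d) z} (hv : ‖v‖ = 1) (hw : ‖w - σ • v‖ ≤ η * σ) :
    w ∈ tangentCone rb θ v ∧ ‖w‖ ≤ 2 * σ := by
  have h1 : ‖w‖ ≤ σ * (1 + η) := by
    have := norm_add_le (w - σ • v) (σ • v)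
    rw [sub_add_cancel, norm_smul, hv, Real.norm_of_nonneg hσ.le] at this
    linarith
  have h2 : ‖w‖ ≤ 2 * σ := by nlinarith
  refine ⟨⟨h2.trans hrb, ?_⟩, h2⟩
  have h3 : inner ℝ v w = σ + inner ℝ v (w - σ • v) := by
    rw [inner_sub_right, real_inner_smul_right, real_inner_self_eq_norm_sq, hv]; ring
  have h4 : |inner ℝ v (w - σ • v)| ≤ η * σ :=
    (abs_real_inner_le_norm _ _).trans (by rw [hv, one_mul]; exact hw)
  rw [h3]
  have h5 := (abs_le.1 h4).1
  have h6 : Real.cos θ * ‖w‖ ≤ Real.cos θ * (σ * (1 + η)) := by gcongr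
  nlinarith

/-- The metric matrix is the Gram matrix of the pushed basis vectors, which are independent by the
lower bound on the metric. -/
theorem volumeDensity_pos {e : OpenPartialHomeomorph M 𝔼(d)} {s : Set 𝔼(d)} {L : ℝ}
    (h : ChartBounds e s L) {y : 𝔼(d)} (hy : y ∈ s) : 0 < volumeDensity e y := by
  have hinj : Function.Injective (chartPush e y) := by
    rw [injective_iff_map_eq_zero]
    intro a ha
    have := h.le_norm_push y hy a
    rw [ha, norm_zero, mul_zero] at this
    exact norm_le_zero_iff.1 this
  have hli : LinearIndependent ℝ fun i : Fin d => chartPush e y (EuclideanSpace.single i 1) := by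
    have h1 := (EuclideanSpace.basisFun (Fin d) ℝ).toBasis.linearIndependent
    have h2 := h1.map' (chartPush e y : 𝔼(d) →ₗ[ℝ] TangentSpace (𝓡 d) (e.symm y))
      (LinearMap.ker_eq_bot.2 hinj)
    have h3 : (fun i : Fin d => chartPush e y (EuclideanSpace.single i 1)) =
        chartPush e y ∘ (EuclideanSpace.basisFun (Fin d) ℝ).toBasis := by
      funext i
      simp
    rw [h3]
    exact h2
  have := (Matrix.posDef_gram_of_linearIndependent hli).det_pos
  exact Real.sqrt_pos.2 this

variable [IsManifold (𝓡 d) ∞ M]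
  [IsContMDiffRiemannianBundle (𝓡 d) ∞ 𝔼(d) (fun x : M => TangentSpace (𝓡 d) x)]

theorem continuousOn_volumeDensity {e : OpenPartialHomeomorph M 𝔼(d)} (he : e ∈ atlas 𝔼(d) M) :
    ContinuousOn (volumeDensity e) e.target := by
  refine Real.continuous_sqrt.comp_continuousOn ?_
  refine (continuous_id.matrix_det).comp_continuousOn ?_
  exact continuousOn_pi.2 fun i => continuousOn_pi.2 fun j =>
    (contDiffOn_chartMetric he _ _).continuousOn

variable [IsRiemannianManifold (𝓡 d) M]

set_option maxHeartbeats 2000000 in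
/-- Around each point, the interior cone condition at scale `s` gives a ball of comparable radius in
the domain. -/
theorem exists_ball_subset_of_cone (z₀ : M) {rb θ : ℝ} (hrb : 0 < rb) (hθ : 0 < θ)
    (hθ' : θ < Real.pi / 2) :
    ∃ U ∈ 𝓝 z₀, ∃ c : ℝ, 0 < c ∧ ∃ s₀ : ℝ, 0 < s₀ ∧ ∀ z ∈ U, ∀ Ω : Set M,
      (∃ v : TangentSpace (𝓡 d) z, ‖v‖ = 1 ∧ tangentCone rb θ v ⊆ expDomain z ∧
        ∀ w ∈ tangentCone rb θ v, riemannianExp z w ∈ Ω) →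
      ∀ s : ℝ, 0 < s → s ≤ s₀ → ∃ y, dist y z ≤ s ∧ Metric.ball y (c * s) ⊆ Ω := by
  obtain ⟨r, hr, L, h⟩ := exists_chartBounds (d := d) z₀
  set e := chartAt 𝔼(d) z₀ with he
  set y₀ := e z₀ with hy₀
  have hz₀ : z₀ ∈ e.source := mem_chart_source _ _
  have hL := h.one_le
  have hW : e.source ∩ e ⁻¹' Metric.ball y₀ (r / 2) ∈ 𝓝 z₀ :=
    Filter.inter_mem (e.open_source.mem_nhds hz₀)
      ((e.continuousAt hz₀) (Metric.ball_mem_nhds _ (half_pos hr)))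
  obtain ⟨δ, hδ, hδW⟩ := Metric.mem_nhds_iff.1 hW
  have hcos : 0 < Real.cos θ := Real.cos_pos_of_mem_Ioo ⟨by linarith, hθ'⟩
  have hcos1 : Real.cos θ < 1 := by
    rw [← Real.cos_zero]
    exact Real.cos_lt_cos_of_nonneg_of_le_pi le_rfl (by linarith [Real.pi_pos]) hθ
  -- The solution of cos θ (1 + η) = 1 - η.
  set η := (1 - Real.cos θ) / (1 + Real.cos θ) with hη
  have hη0 : 0 < η := div_pos (by linarith) (by linarith)
  have hηeq : η * (1 + Real.cos θ) = 1 - Real.cos θ := div_mul_cancel₀ _ (by linarith)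
  have hη1 : η ≤ 1 := by nlinarith
  refine ⟨Metric.ball z₀ (δ / 2), Metric.ball_mem_nhds _ (half_pos hδ), η / (8 * L ^ 4),
    by positivity, min (min (r / 4) (1 / 12)) (min rb (δ / 8)), by positivity, ?_⟩
  rintro z hz Ω ⟨v, hv, hdom, hΩ⟩ s hs hs₀
  have hs1 : s ≤ r / 4 := hs₀.trans ((min_le_left _ _).trans (min_le_left _ _))
  have hs2 : s ≤ 1 / 12 := hs₀.trans ((min_le_left _ _).trans (min_le_right _ _))
  have hs3 : s ≤ rb := hs₀.trans ((min_le_right _ _).trans (min_le_left _ _))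
  have hs4 : s ≤ δ / 8 := hs₀.trans ((min_le_right _ _).trans (min_le_right _ _))
  have hL0 : 0 < L := by linarith
  -- Vectors of norm at most 2σ have coordinates of norm at most a = 2Lσ; their geodesics move by at
  -- most 2a in the chart, hence by at most 2La = s in M.
  set σ := s / (4 * L ^ 2) with hσ
  have hσ0 : 0 < σ := by positivity
  have hσs : 4 * L ^ 2 * σ = s := by rw [hσ]; field_simp
  have hLσ : 4 * (L * σ) ≤ s := by
    rw [← hσs]; nlinarith [mul_pos hL0 hσ0]
  have hσ1 : σ ≤ L * σ := le_mul_of_one_le_left hσ0.le hL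
  set a := 2 * (L * σ) with ha
  have ha0 : 0 < a := by positivity
  have hzW := hδW (Metric.ball_subset_ball (by linarith) hz)
  have hzs : z ∈ e.source := hzW.1
  have hzr : ‖e z - y₀‖ < r / 2 := by
    have := hzW.2
    rwa [Set.mem_preimage, Metric.mem_ball, dist_eq_norm] at this
  have hzb : e z ∈ Metric.closedBall y₀ r := by
    rw [Metric.mem_closedBall, dist_eq_norm]; linarith
  have hM := IsManifold.of_le (I := 𝓡 d) (M := M) (m := 1) (n := ∞) (by simp)
  have hsurj : Function.Surjective (chartCoord e z) :=
    (mdifferentiable_of_mem_atlas (I := 𝓡 d) h.mem_atlas).mfderiv_surjective hzs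
  set g := Function.surjInv hsurj with hg
  have hgA : ∀ b, chartCoord e z (g b) = b := Function.surjInv_eq hsurj
  set b₀ := chartCoord e z (σ • v) with hb₀
  -- Coordinates within ε of those of σv belong to vectors within ησ of σv, hence in the cone.
  set ε := η * σ / L with hε
  have hε0 : 0 < ε := by positivity
  have hcone : ∀ w : TangentSpace (𝓡 d) z, ‖chartCoord e z w - b₀‖ ≤ ε →
      w ∈ tangentCone rb θ v ∧ ‖chartCoord e z w‖ ≤ a := by
    intro w hw
    have h1 : ‖w - σ • v‖ ≤ η * σ := by
      refine (norm_le_norm_chartCoord h hzs hzb _).trans ?_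
      rw [map_sub]
      calc L * ‖chartCoord e z w - b₀‖ ≤ L * ε := by gcongr
        _ = η * σ := by rw [hε]; field_simp
    obtain ⟨h2, h3⟩ := mem_tangentCone_of_norm_sub_le (rb := rb) (θ := θ) hσ0 hη1 hcos.le
      (by nlinarith) (by linarith) hv h1
    refine ⟨h2, (norm_chartCoord_le h hzs hzb w).trans ?_⟩
    rw [ha]
    nlinarith
  have hcomp : ∀ w w' : TangentSpace (𝓡 d) z, ‖chartCoord e z w - b₀‖ ≤ ε →
      ‖chartCoord e z w' - b₀‖ ≤ ε → _ := fun w w' hw hw' =>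
    geodesic_chart_sub h hzs hzr.le ha0 (by linarith) (by rw [ha]; nlinarith) (hcone w hw).2
      (hcone w' hw').2 (hdom (hcone w hw).1) (hdom (hcone w' hw').1)
  set F : 𝔼(d) → 𝔼(d) := fun b => e (riemannianExp z (g b)) with hF
  have hball : ∀ b ∈ Metric.closedBall b₀ ε, ‖chartCoord e z (g b) - b₀‖ ≤ ε := by
    intro b hb
    rwa [hgA, ← dist_eq_norm]
  -- The exponential map in coordinates covers the ball of radius ε/2 around e y. The chart maps the
  -- ball of radius ε/(2L) = ηs/(8L⁴) around y into it.
  have himg := closedBall_subset_image (F := F) (b := b₀) hε0.le fun b hb b' hb' => by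
    have := (hcomp (g b) (g b') (hball b hb) (hball b' hb')).2.2
    rwa [hgA, hgA] at this
  have hb₀m : b₀ ∈ Metric.closedBall b₀ ε := Metric.mem_closedBall_self hε0.le
  set y := riemannianExp z (g b₀) with hy
  obtain ⟨⟨hys, hyb⟩, hyd, -⟩ := hcomp (g b₀) (g b₀) (hball _ hb₀m) (hball _ hb₀m)
  rw [← hy] at hys hyb hyd
  have hyz : dist y z ≤ s := by
    have := dist_symm_le h (convex_closedBall _ _) hyb hzb
    rw [e.left_inv hys, e.left_inv hzs] at this
    refine this.trans ?_
    calc L * ‖e y - e z‖ ≤ L * (2 * a) := by gcongr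
      _ = s := by rw [← hσs, ha]; ring
  refine ⟨y, hyz, fun y' hy' => ?_⟩
  have hcs : η / (8 * L ^ 4) * s = ε / 2 / L := by
    rw [← hσs, hε]; field_simp; ring
  have hsmall : ε / 2 / L ≤ δ / 8 := by
    have h1 : ε ≤ σ := by
      rw [hε, div_le_iff₀ hL0]; nlinarith
    rw [div_le_iff₀ hL0]
    nlinarith
  have hyball : ∀ x ∈ Metric.ball y (δ / 4), x ∈ e.source ∧ e x ∈ Metric.closedBall y₀ r := by
    intro x hx
    have : x ∈ Metric.ball z₀ δ := by
      rw [Metric.mem_ball] at hx hz ⊢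
      linarith [dist_triangle x y z₀, dist_triangle y z z₀]
    exact ⟨(hδW this).1, Metric.ball_subset_closedBall
      (Metric.ball_subset_ball (by linarith) (hδW this).2)⟩
  rw [hcs] at hy'
  have hy'b : y' ∈ Metric.ball y (δ / 4) := Metric.ball_subset_ball (by linarith) hy'
  have hy'd : e y' ∈ Metric.closedBall (F b₀) (ε / 2) := by
    rw [Metric.mem_closedBall, dist_eq_norm]
    refine (norm_chart_sub_le h hyball hy'b).trans ?_
    rw [Metric.mem_ball, lt_div_iff₀ hL0] at hy'
    linarith
  obtain ⟨b, hb, hbe⟩ := himg hy'd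
  have hbs := (hcomp (g b) (g b) (hball _ hb) (hball _ hb)).1.1
  have : riemannianExp z (g b) = y' := e.injOn hbs (hyball y' hy'b).1 hbe
  rw [← this]
  exact hΩ _ (hcone _ (hball _ hb)).1

/-- Small balls have at least Euclidean volume, up to a locally uniform constant. -/
theorem exists_volume_ball_ge [MeasurableSpace M] [BorelSpace M] (z₀ : M) :
    ∃ U ∈ 𝓝 z₀, ∃ c : ℝ, 0 < c ∧ ∃ t₀ : ℝ, 0 < t₀ ∧ ∀ z ∈ U, ∀ t : ℝ, 0 < t → t ≤ t₀ →
      ENNReal.ofReal (c * t ^ d) ≤ riemannianVolume d M (Metric.ball z t) := by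
  obtain ⟨r, hr, L, h⟩ := exists_chartBounds (d := d) z₀
  set e := chartAt 𝔼(d) z₀ with he
  set y₀ := e z₀ with hy₀
  have hz₀ : z₀ ∈ e.source := mem_chart_source _ _
  have hL := h.one_le
  have hL0 : 0 < L := by linarith
  have hy₀s : y₀ ∈ Metric.closedBall y₀ r := Metric.mem_closedBall_self hr.le
  have hy₀t : e.target ∈ 𝓝 y₀ := e.open_target.mem_nhds (e.map_source hz₀)
  have hpos := volumeDensity_pos h hy₀s
  -- By continuity the density stays above half its value at y₀; B(z, t) contains the image of a
  -- coordinate ball of radius t/L.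
  set κ := volumeDensity e y₀ / 2 with hκ
  have hκ0 : 0 < κ := half_pos hpos
  have hev : ∀ᶠ y in 𝓝 y₀, κ < volumeDensity e y :=
    continuousAt_const.eventually_lt
      ((continuousOn_volumeDensity h.mem_atlas).continuousAt hy₀t) (half_lt_self hpos)
  obtain ⟨r', hr', hball⟩ := Metric.nhds_basis_closedBall.mem_iff.1
    (Filter.inter_mem hev (Metric.closedBall_mem_nhds y₀ hr))
  set β := (MeasureTheory.volume (Metric.ball (0 : 𝔼(d)) 1)).toReal with hβ
  have hβ0 : 0 < β := ENNReal.toReal_pos (Metric.measure_ball_pos _ _ one_pos).ne'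
    MeasureTheory.measure_ball_lt_top.ne
  refine ⟨e.source ∩ e ⁻¹' Metric.ball y₀ (r' / 2),
    Filter.inter_mem (e.open_source.mem_nhds hz₀)
      ((e.continuousAt hz₀) (Metric.ball_mem_nhds _ (half_pos hr'))),
    κ * (β / L ^ d), by positivity, r' / 2, half_pos hr', ?_⟩
  rintro z ⟨hzs, hzb⟩ t ht ht₀
  have hsub : Metric.ball (e z) (t / L) ⊆ Metric.closedBall y₀ r' := by
    intro y hy
    have h1 : t / L ≤ t := div_le_self ht.le hL
    rw [Set.mem_preimage, Metric.mem_ball] at hzb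
    rw [Metric.mem_ball] at hy
    rw [Metric.mem_closedBall]
    linarith [dist_triangle y (e z) y₀]
  have hsub' : Metric.ball (e z) (t / L) ⊆ e.target := fun y hy =>
    h.subset_target (hball (hsub hy)).2
  have hez : e z ∈ Metric.closedBall y₀ r :=
    (hball (hsub (Metric.mem_ball_self (by positivity)))).2
  have hpre : Metric.ball (e z) (t / L) ⊆ e.symm ⁻¹' Metric.ball z t := by
    intro y hy
    have h1 := dist_symm_le h (convex_closedBall _ _) (hball (hsub hy)).2 hez
    rw [e.left_inv hzs, ← dist_eq_norm] at h1
    rw [Metric.mem_ball, lt_div_iff₀ hL0] at hy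
    rw [Set.mem_preimage, Metric.mem_ball]
    linarith
  have hmeas : AEMeasurable e.symm ((MeasureTheory.volume.restrict e.target).withDensity
      (fun y => ENNReal.ofReal (volumeDensity e y))) :=
    (e.continuousOn_symm.aemeasurable e.open_target.measurableSet).mono_ac
      (MeasureTheory.withDensity_absolutelyContinuous _ _)
  -- For a lower bound a single chart suffices, the volume being a supremum of chart measures.
  have hle : chartVolume e ≤ riemannianVolume d M :=
    le_iSup₂ (f := fun e (_ : e ∈ atlas 𝔼(d) M) => chartVolume e) e h.mem_atlas
  refine le_trans ?_ (hle _)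
  rw [chartVolume, MeasureTheory.Measure.map_apply_of_aemeasurable hmeas measurableSet_ball]
  refine le_trans ?_ (MeasureTheory.measure_mono hpre)
  rw [MeasureTheory.withDensity_apply _ measurableSet_ball,
    MeasureTheory.Measure.restrict_restrict measurableSet_ball,
    Set.inter_eq_left.2 hsub']
  calc ENNReal.ofReal (κ * (β / L ^ d) * t ^ d)
      = ENNReal.ofReal κ * MeasureTheory.volume (Metric.ball (e z) (t / L)) := by
        rw [MeasureTheory.Measure.addHaar_ball_of_pos _ _ (by positivity), finrank_euclideanSpace_fin,
          ← ENNReal.ofReal_toReal (MeasureTheory.measure_ball_lt_top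
            (μ := MeasureTheory.volume) (x := (0 : 𝔼(d))) (r := 1)).ne, ← hβ,
          ← ENNReal.ofReal_mul (by positivity), ← ENNReal.ofReal_mul hκ0.le]
        congr 1
        rw [div_pow]
        ring
    _ = ∫⁻ _ in Metric.ball (e z) (t / L), ENNReal.ofReal κ := by simp
    _ ≤ _ := MeasureTheory.setLIntegral_mono' measurableSet_ball fun y hy =>
        ENNReal.ofReal_le_ofReal (le_of_lt (hball (hsub hy)).1)

end LocalGeometry

/-- Finitely many neighbourhoods cover Ω, and a property that survives shrinking both constants
holds with the minima. It serves both the cone and the volume estimate. -/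
theorem IsCompact.exists_uniform_pair {X : Type*} [TopologicalSpace X] {Ω : Set X}
    (hΩ : IsCompact Ω) {Q : ℝ → ℝ → X → Prop}
    (mono : ∀ c c' s s' z, 0 < c' → c' ≤ c → 0 < s' → s' ≤ s → Q c s z → Q c' s' z)
    (loc : ∀ z₀ ∈ Ω, ∃ U ∈ 𝓝 z₀, ∃ c : ℝ, 0 < c ∧ ∃ s : ℝ, 0 < s ∧ ∀ z ∈ U, z ∈ Ω → Q c s z) :
    ∃ c : ℝ, 0 < c ∧ ∃ s : ℝ, 0 < s ∧ ∀ z ∈ Ω, Q c s z := by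
  have h := hΩ.induction_on
    (p := fun S => ∃ c : ℝ, 0 < c ∧ ∃ s : ℝ, 0 < s ∧ ∀ z ∈ S, z ∈ Ω → Q c s z)
    ⟨1, one_pos, 1, one_pos, fun z hz => hz.elim⟩
    (fun S T hST ⟨c, hc, s, hs, h⟩ => ⟨c, hc, s, hs, fun z hz => h z (hST hz)⟩)
    (fun S T ⟨c, hc, s, hs, h⟩ ⟨c', hc', s', hs', h'⟩ =>
      ⟨min c c', lt_min hc hc', min s s', lt_min hs hs', fun z hz hzΩ => hz.elim
        (fun hz => mono _ _ _ _ z (lt_min hc hc') (min_le_left _ _) (lt_min hs hs')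
          (min_le_left _ _) (h z hz hzΩ))
        (fun hz => mono _ _ _ _ z (lt_min hc hc') (min_le_right _ _) (lt_min hs hs')
          (min_le_right _ _) (h' z hz hzΩ))⟩)
    (fun z₀ hz₀ => by
      obtain ⟨U, hU, c, hc, s, hs, h⟩ := loc z₀ hz₀
      exact ⟨U, mem_nhdsWithin_of_mem_nhds hU, c, hc, s, hs, h⟩)
  obtain ⟨c, hc, s, hs, h⟩ := h
  exact ⟨c, hc, s, hs, fun z hz => h z hz hz⟩

/-! ### Supremum norms and iterated doubling. -/

section SupNorm

variable {M : Type*} {p : M → ℝ}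

theorem supNorm_mono {s t : Set M} (h : s ⊆ t) : supNorm p s ≤ supNorm p t :=
  biSup_mono h

theorem supNorm_le_ofReal {s : Set M} {C : ℝ} (h : ∀ x ∈ s, ‖p x‖ ≤ C) :
    supNorm p s ≤ ENNReal.ofReal C :=
  iSup₂_le fun x hx => by
    rw [← ofReal_norm]
    exact ENNReal.ofReal_le_ofReal (h x hx)

/-- Only the radii 2^j r with j < k must be admissible; the final radius 2^k r may exceed `rs`. -/
theorem supNorm_ball_two_pow_mul_le [MetricSpace M] {x : M} {A : ℝ≥0∞} {rs r : ℝ} (hr : 0 < r)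
    (hdouble : ∀ r : ℝ, 0 < r → r < rs →
      supNorm p (Metric.ball x (2 * r)) ≤ A * supNorm p (Metric.ball x r)) (k : ℕ)
    (hk : ∀ j < k, 2 ^ j * r < rs) :
    supNorm p (Metric.ball x (2 ^ k * r)) ≤ A ^ k * supNorm p (Metric.ball x r) := by
  induction k with
  | zero => simp
  | succ k ih =>
    have h1 := hdouble (2 ^ k * r) (by positivity) (hk k (Nat.lt_succ_self k))
    rw [pow_succ', mul_assoc, pow_succ', mul_assoc]
    exact h1.trans (by gcongr; exact ih fun j hj => hk j (hj.trans (Nat.lt_succ_self k)))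

end SupNorm

/-! ### From the gradient bound to a lower bound of the L_q norm. -/

section Nikolskii

variable {d : ℕ} {M : Type*} [MetricSpace M] [ChartedSpace (EuclideanSpace ℝ (Fin d)) M]
  [Bundle.RiemannianBundle (fun x : M => TangentSpace (𝓡 d) x)]

theorem norm_mfderiv_le_of_gradNorm_le {p : M → ℝ} {x : M} {G : ℝ} (hG : 0 ≤ G)
    (h : gradNorm d p x ≤ ENNReal.ofReal G) (w : TangentSpace (𝓡 d) x) :
    ‖(show ℝ from mfderiv (𝓡 d) 𝓘(ℝ, ℝ) p x w)‖ ≤ G * ‖w‖ := by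
  rcases eq_or_ne w 0 with rfl | hw
  · have : (show ℝ from mfderiv (𝓡 d) 𝓘(ℝ, ℝ) p x 0) = 0 :=
      map_zero (mfderiv (𝓡 d) 𝓘(ℝ, ℝ) p x)
    rw [this]
    simp
  · have h1 : ENNReal.ofReal (|(show ℝ from mfderiv (𝓡 d) 𝓘(ℝ, ℝ) p x w)| / ‖w‖) ≤
        ENNReal.ofReal G := (le_iSup₂ (f := fun (V : TangentSpace (𝓡 d) x) (_ : V ≠ 0) =>
          ENNReal.ofReal (|(show ℝ from mfderiv (𝓡 d) 𝓘(ℝ, ℝ) p x V)| / ‖V‖)) w hw).trans h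
    rw [ENNReal.ofReal_le_ofReal_iff hG, div_le_iff₀ (norm_pos_iff.2 hw)] at h1
    exact h1

/-- Chebyshev's inequality: shrink the domain to s and compare f with the constant a. -/
theorem ofReal_mul_rpow_le_eLpNorm {α : Type*} [MeasurableSpace α] {μ : MeasureTheory.Measure α}
    {f : α → ℝ} {s t : Set α} (hs : MeasurableSet s) (hst : s ⊆ t) {a q : ℝ} (ha : 0 ≤ a)
    (hq : 1 ≤ q) (hf : ∀ x ∈ s, a ≤ ‖f x‖) :
    ENNReal.ofReal a * μ s ^ (1 / q) ≤
      MeasureTheory.eLpNorm f (ENNReal.ofReal q) (μ.restrict t) := by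
  have hq0 : 0 < q := by linarith
  have h1 : MeasureTheory.eLpNorm (fun _ : α => a) (ENNReal.ofReal q) (μ.restrict s) =
      ENNReal.ofReal a * μ s ^ (1 / q) := by
    rw [MeasureTheory.eLpNorm_const' _ (by simpa using hq0) ENNReal.ofReal_ne_top,
      ENNReal.toReal_ofReal hq0.le, MeasureTheory.Measure.restrict_apply_univ,
      Real.enorm_eq_ofReal ha]
  rw [← h1]
  refine le_trans ?_ (MeasureTheory.eLpNorm_mono_measure f
    (MeasureTheory.Measure.restrict_mono hst le_rfl))
  refine MeasureTheory.eLpNorm_mono_ae ?_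
  filter_upwards [MeasureTheory.self_mem_ae_restrict hs] with x hx
  rw [Real.norm_of_nonneg ha]
  exact hf x hx

variable [IsManifold (𝓡 d) ∞ M] [IsRiemannianManifold (𝓡 d) M]

/-- A function of the space is large on a ball of comparable radius around a point near which it
almost attains its supremum. -/
theorem FunctionSpaceAssumption.exists_large_on_ball {P : Submodule ℝ (M → ℝ)} {D K rs : ℝ}
    (hP : FunctionSpaceAssumption d P D K rs) {p : M → ℝ} (hp : p ∈ P) {y : M} {r A K' m : ℝ}
    (hr : 0 < r) (hrs : 2 * r < rs) (hA : 1 ≤ A) (hDA : (2 : ℝ) ^ D ≤ A) (hK' : 1 ≤ K')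
    (hKK' : K ≤ K') (hm : 0 < m) (hsup : supNorm p (Metric.ball y r) = ENNReal.ofReal m) :
    ∃ z ∈ Metric.ball y r, Metric.ball z (r / (2 * K' * A)) ⊆ Metric.ball y (2 * r) ∧
      ∀ x ∈ Metric.ball z (r / (2 * K' * A)), m / 4 ≤ ‖p x‖ := by
  obtain ⟨z, hz, hpz⟩ : ∃ z ∈ Metric.ball y r, m / 2 < ‖p z‖ := by
    have h1 : ENNReal.ofReal (m / 2) < supNorm p (Metric.ball y r) := by
      rw [hsup]
      exact (ENNReal.ofReal_lt_ofReal_iff hm).2 (half_lt_self hm)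
    obtain ⟨z, h2⟩ := lt_iSup_iff.1 h1
    obtain ⟨hz, h3⟩ := lt_iSup_iff.1 h2
    rw [← ofReal_norm] at h3
    exact ⟨z, hz, (ENNReal.ofReal_lt_ofReal_iff_of_nonneg (by positivity)).1 h3⟩
  have hKA : 1 ≤ K' * A := one_le_mul_of_one_le_of_one_le hK' hA
  have hρ : r / (2 * K' * A) ≤ r := div_le_self hr.le (by linarith)
  have hsub : Metric.ball z (r / (2 * K' * A)) ⊆ Metric.ball y (2 * r) := by
    intro x hx
    rw [Metric.mem_ball] at hx hz ⊢
    linarith [dist_triangle x z y]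
  refine ⟨z, hz, hsub, fun x hx => ?_⟩
  -- The gradient bound is taken on B(y, 2r), since z may lie near the boundary of B(y, r). The
  -- radius r/(2K'A) is chosen so that p varies by at most m/4.
  set G := K' / (2 * r) * (A * m) with hG
  have hG0 : 0 ≤ G := by positivity
  have hgrad : gradSupNorm d p (Metric.ball y (2 * r)) ≤ ENNReal.ofReal G := by
    refine (hP.markov p hp (2 * r) (by positivity) hrs y).trans ?_
    rw [hG, ENNReal.ofReal_mul (by positivity), ENNReal.ofReal_mul (by positivity)]
    gcongr
    refine (hP.doubling p hp r hr (by linarith) y).trans ?_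
    rw [hsup]
    gcongr
  have hmv := norm_sub_le_mul_dist (d := d) (F := ℝ) hG0 (hP.contMDiff p hp).contMDiffOn
    (fun x hx => norm_mfderiv_le_of_gradNorm_le hG0
      ((le_iSup₂ (f := fun x (_ : x ∈ Metric.ball y (2 * r)) => gradNorm d p x) x
        (hsub hx)).trans hgrad)) hx
  have h1 : G * dist x z ≤ G * (r / (2 * K' * A)) := by
    gcongr
    exact (Metric.mem_ball.1 hx).le
  have h2 : G * (r / (2 * K' * A)) = m / 4 := by
    rw [hG]
    field_simp
    norm_num
  have h3 := norm_sub_norm_le (p z) (p x)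
  rw [norm_sub_rev] at h3
  linarith

variable [IsContMDiffRiemannianBundle (𝓡 d) ∞ (EuclideanSpace ℝ (Fin d))
    (fun x : M => TangentSpace (𝓡 d) x)]

theorem DomainAssumption.exists_ball_subset {Ω : Set M} {rb θ : ℝ}
    (hΩ : DomainAssumption d Ω rb θ) :
    ∃ c : ℝ, 0 < c ∧ ∃ s₀ : ℝ, 0 < s₀ ∧ ∀ z ∈ Ω, ∀ s : ℝ, 0 < s → s ≤ s₀ →
      ∃ y, dist y z ≤ s ∧ Metric.ball y (c * s) ⊆ Ω := by
  refine IsCompact.exists_uniform_pair hΩ.isCompact ?_ fun z₀ _ => ?_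
  · intro c c' s s' z _ hc _ hs h t ht hts
    obtain ⟨y, hy, hyΩ⟩ := h t ht (hts.trans hs)
    exact ⟨y, hy, (Metric.ball_subset_ball (by gcongr)).trans hyΩ⟩
  · obtain ⟨U, hU, c, hc, s, hs, h⟩ := exists_ball_subset_of_cone (d := d) z₀ hΩ.rb_pos
      hΩ.aperture_pos hΩ.aperture_lt
    exact ⟨U, hU, c, hc, s, hs, fun z hz hzΩ => h z hz Ω (hΩ.cone z hzΩ)⟩

theorem exists_volume_ball_ge_on [MeasurableSpace M] [BorelSpace M] {Ω : Set M}
    (hΩ : IsCompact Ω) :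
    ∃ c : ℝ, 0 < c ∧ ∃ t₀ : ℝ, 0 < t₀ ∧ ∀ z ∈ Ω, ∀ t : ℝ, 0 < t → t ≤ t₀ →
      ENNReal.ofReal (c * t ^ d) ≤ riemannianVolume d M (Metric.ball z t) := by
  refine IsCompact.exists_uniform_pair hΩ ?_ fun z₀ _ => ?_
  · intro c c' s s' z _ hc _ hs h t ht hts
    exact (ENNReal.ofReal_le_ofReal (by gcongr)).trans (h t ht (hts.trans hs))
  · obtain ⟨U, hU, c, hc, s, hs, h⟩ := exists_volume_ball_ge (d := d) z₀
    exact ⟨U, hU, c, hc, s, hs, fun z hz _ => h z hz⟩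

end Nikolskii

end RiemannianNikolskii

end

/-! ### The Nikolskii inequality. -/

theorem corollary3p5 {d : ℕ} {M : Type*} [MetricSpace M] [ConnectedSpace M]
    [ChartedSpace (EuclideanSpace ℝ (Fin d)) M] [IsManifold (𝓡 d) ∞ M]
    [Bundle.RiemannianBundle (fun x : M => TangentSpace (𝓡 d) x)]
    [IsContMDiffRiemannianBundle (𝓡 d) ∞ (EuclideanSpace ℝ (Fin d))
      (fun x : M => TangentSpace (𝓡 d) x)]
    [IsRiemannianManifold (𝓡 d) M]
    [MeasurableSpace M] [BorelSpace M]
    (P : Submodule ℝ (M → ℝ)) (D K rs : ℝ)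
    (hP : RiemannianNikolskii.FunctionSpaceAssumption d P D K rs)
    (Ω : Set M) (rb θ : ℝ)
    (hΩ : RiemannianNikolskii.DomainAssumption d Ω rb θ) :
    ∃ N : ℝ, 0 < N ∧
      ∀ q : ℝ, 1 ≤ q →
      ∀ x₀ ∈ Ω, ∀ R : ℝ, 0 < R → ENNReal.ofReal R ≤ RiemannianNikolskii.rStar d Ω rs rb →
      ∀ p ∈ P,
        RiemannianNikolskii.supNorm p (closure (Metric.ball x₀ R) ∩ Ω) ≤
          ENNReal.ofReal (N * R ^ (-(d : ℝ) / q)) *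
            MeasureTheory.eLpNorm p (ENNReal.ofReal q)
              ((RiemannianNikolskii.riemannianVolume d M).restrict (Metric.ball x₀ R ∩ Ω)) := by
  have hrs := hP.rs_pos
  obtain ⟨c, hc, s₀, hs₀, hcone⟩ := hΩ.exists_ball_subset
  obtain ⟨c', hc', t₀, ht₀, hvol⟩ :=
    RiemannianNikolskii.exists_volume_ball_ge_on (d := d) hΩ.isCompact
  set A : ℝ := max 1 (2 ^ D) 
  have hA : 1 ≤ A := le_max_left _ _
  set K' : ℝ := max 1 K 
  have hK' : 1 ≤ K' := le_max_left _ _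
  -- With R ≤ `rs` the scale σR is at most s₀, and y stays within R/4 of x₀. Then ρ ≤ 1/2 keeps B(y,
  -- ρR) inside B(x₀, R).
  set σ : ℝ := min (1 / 4) (s₀ / rs) with hσ
  have hσ0 : 0 < σ := by positivity
  set ρ : ℝ := min (1 / 2) (c * σ) with hρ
  have hρ0 : 0 < ρ := by positivity
  have hρ2 : ρ ≤ 1 / 2 := min_le_left _ _
  obtain ⟨k, hk⟩ : ∃ k : ℕ, 3 / ρ < 2 ^ k := pow_unbounded_of_one_lt _ one_lt_two
  have h2k : (0 : ℝ) < 2 ^ k := by positivity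
  have hk3 : 3 / 2 ^ k < ρ := by
    rw [div_lt_iff₀ hρ0] at hk
    rw [div_lt_iff₀ h2k]
    linarith
  set ν : ℝ := min (3 / 2 / 2 ^ k / (2 * K' * A)) (t₀ / rs) with hν
  have hν0 : 0 < ν := by positivity
  -- Capped at 1 so that V ≤ V^(1/q) for all q ≥ 1, which makes the final constant independent of q.
  set V : ℝ := min 1 (c' * ν ^ d) with hV
  have hV0 : 0 < V := by positivity
  have hV1 : V ≤ 1 := min_le_left _ _
  refine ⟨A ^ k * (4 / V), by positivity, ?_⟩
  intro q hq x₀ hx₀ R hR hRr p hp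
  have hRrs : R ≤ rs := by
    have h1 := hRr.trans ((min_le_right _ _).trans (min_le_left _ _))
    rwa [ENNReal.ofReal_le_ofReal_iff hrs.le] at h1
  obtain ⟨y, hyx, hyΩ⟩ := hcone x₀ hx₀ (σ * R) (by positivity) (by
    calc σ * R ≤ s₀ / rs * rs := by gcongr; exact min_le_right _ _
      _ = s₀ := by field_simp)
  have hyx' : dist y x₀ ≤ R / 4 := hyx.trans (by
    have : σ ≤ 1 / 4 := min_le_left _ _
    nlinarith)
  have hball : Metric.ball y (ρ * R) ⊆ Metric.ball x₀ R ∩ Ω := by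
    intro x hx
    refine ⟨?_, hyΩ (Metric.ball_subset_ball ?_ hx)⟩
    · rw [Metric.mem_ball] at hx ⊢
      have := dist_triangle x y x₀
      nlinarith
    · rw [← mul_assoc]
      gcongr
      exact min_le_right _ _
  -- After k doublings the radius is 3R/2 > R + R/4, enough to cover the closure of B(x₀, R); the
  -- choice of k gives 2r ≤ ρR.
  set r : ℝ := 3 / 2 * R / 2 ^ k with hr
  have hr0 : 0 < r := by positivity
  have h2kr : 2 ^ k * r = 3 / 2 * R := by rw [hr]; field_simp
  have h2r : 2 * r ≤ ρ * R := by
    have : 2 * r = 3 / 2 ^ k * R := by rw [hr]; ring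
    rw [this]
    gcongr
  have h2rs : 2 * r < rs := by nlinarith
  have hsub2 : Metric.ball y (2 * r) ⊆ Metric.ball x₀ R ∩ Ω :=
    (Metric.ball_subset_ball h2r).trans hball
  have hsub1 : Metric.ball y r ⊆ Metric.ball x₀ R ∩ Ω :=
    (Metric.ball_subset_ball (by linarith)).trans hsub2
  have hpc : Continuous p := (hP.contMDiff p hp).continuous
  obtain ⟨C, hC⟩ := hΩ.isCompact.exists_bound_of_continuousOn hpc.continuousOn
  have hfin : RiemannianNikolskii.supNorm p (Metric.ball y r) ≠ ⊤ :=
    ((RiemannianNikolskii.supNorm_le_ofReal fun x hx => hC x (hsub1 hx).2).trans_lt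
      ENNReal.ofReal_lt_top).ne
  have hlarge : RiemannianNikolskii.supNorm p (closure (Metric.ball x₀ R) ∩ Ω) ≤
      ENNReal.ofReal A ^ k * RiemannianNikolskii.supNorm p (Metric.ball y r) := by
    refine le_trans (RiemannianNikolskii.supNorm_mono ?_)
      (RiemannianNikolskii.supNorm_ball_two_pow_mul_le (rs := rs) hr0 (fun r hr hrs =>
        (hP.doubling p hp r hr hrs y).trans ?_) k fun j hj => ?_)
    · rintro x ⟨hx, -⟩
      have h1 := Metric.closure_ball_subset_closedBall hx
      rw [Metric.mem_closedBall] at h1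
      rw [Metric.mem_ball, h2kr]
      have := dist_triangle_right x y x₀
      linarith
    · gcongr
      exact le_max_right _ _
    -- For j < k the radius 2^j r is at most 3R/4 < `rs`, although 3R/2 itself may not be
    -- admissible.
    · have h1 : (2 : ℝ) ^ j * 2 ≤ 2 ^ k := by
        rw [← pow_succ]
        exact pow_le_pow_right₀ one_le_two hj
      nlinarith
  set m := (RiemannianNikolskii.supNorm p (Metric.ball y r)).toReal with hm
  have hsup : RiemannianNikolskii.supNorm p (Metric.ball y r) = ENNReal.ofReal m :=
    (ENNReal.ofReal_toReal hfin).symm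
  rw [hsup, ← ENNReal.ofReal_pow (by positivity), ← ENNReal.ofReal_mul (by positivity)] at hlarge
  refine hlarge.trans ?_
  -- If m = 0, the doubling bound already makes the left side zero.
  rcases (ENNReal.toReal_nonneg : 0 ≤ m).eq_or_lt with hm0 | hm0
  · rw [hm, ← hm0]
    simp
  obtain ⟨z, hz, hzsub, hzp⟩ := hP.exists_large_on_ball hp hr0 h2rs hA (le_max_right _ _) hK'
    (le_max_right _ _) hm0 hsup
  have hνr : ν * R ≤ r / (2 * K' * A) := by
    have h1 : ν * R ≤ 3 / 2 / 2 ^ k / (2 * K' * A) * R := by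
      gcongr
      exact min_le_left _ _
    refine h1.trans_eq ?_
    rw [hr]
    ring
  have hνt : ν * R ≤ t₀ := by
    calc ν * R ≤ t₀ / rs * rs := by gcongr; exact min_le_right _ _
      _ = t₀ := by field_simp
  have hzν : Metric.ball z (ν * R) ⊆ Metric.ball z (r / (2 * K' * A)) :=
    Metric.ball_subset_ball hνr
  have hLq := RiemannianNikolskii.ofReal_mul_rpow_le_eLpNorm
    (μ := RiemannianNikolskii.riemannianVolume d M) (f := p) measurableSet_ball
    ((hzν.trans hzsub).trans hsub2) (a := m / 4) (by positivity) hq fun x hx => hzp x (hzν hx)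
  have hq0 : 0 < q := by linarith
  have hvolz : ENNReal.ofReal (V * R ^ ((d : ℝ) / q)) ≤
      RiemannianNikolskii.riemannianVolume d M (Metric.ball z (ν * R)) ^ (1 / q) := by
    have h1 : ENNReal.ofReal (V * R ^ d) ≤
        RiemannianNikolskii.riemannianVolume d M (Metric.ball z (ν * R)) := by
      refine le_trans (ENNReal.ofReal_le_ofReal ?_)
        (hvol z (hsub1 hz).2 (ν * R) (by positivity) hνt)
      rw [mul_pow, ← mul_assoc]
      gcongr
      exact min_le_right _ _
    refine le_trans ?_ (ENNReal.rpow_le_rpow h1 (by positivity))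
    rw [ENNReal.ofReal_rpow_of_pos (by positivity)]
    refine ENNReal.ofReal_le_ofReal ?_
    rw [Real.mul_rpow hV0.le (by positivity), ← Real.rpow_natCast, ← Real.rpow_mul hR.le,
      mul_one_div]
    gcongr
    exact Real.self_le_rpow_of_le_one hV0.le hV1 ((div_le_one hq0).2 hq)
  calc ENNReal.ofReal (A ^ k * m)
      = ENNReal.ofReal (A ^ k * (4 / V) * R ^ (-(d : ℝ) / q)) *
          (ENNReal.ofReal (m / 4) * ENNReal.ofReal (V * R ^ ((d : ℝ) / q))) := by
        rw [← ENNReal.ofReal_mul (by positivity), ← ENNReal.ofReal_mul (by positivity)]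
        congr 1
        have h1 : R ^ (-(d : ℝ) / q) * R ^ ((d : ℝ) / q) = 1 := by
          rw [← Real.rpow_add hR, neg_div, neg_add_cancel, Real.rpow_zero]
        calc A ^ k * m = A ^ k * (V / V) * m * 1 := by rw [div_self hV0.ne']; ring
          _ = _ := by rw [← h1]; ring
    _ ≤ _ := by
        gcongr
        exact (mul_le_mul_right hvolz _).trans hLq
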